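/- **Setting.** Let $b,d\ge 1$, $k=\dim(\boldsymbol\theta)\ge 0$, and let $x^{(1)},x^{(2)},\dots$ be i.i.d. random vectors in $\mathbb R^d$ with law $Q$ of density $q$. Let $\Theta\subset\mathbb R^{k}$ be compact and convex, let $p(\cdot;\theta)$, $\theta\in\Theta$, be strictly positive probability densities on $\mathbb R^d$, and let $f:\mathbb R^d\to\mathbb R^b$. The Stein feature $T_\theta f(x)\in\mathbb R^b$ has components $$T_\theta f_i(x)=\langle\nabla_x\log p(x;\theta),\nabla f_i(x)\rangle+\operatorname{trace}\nabla^2f_i(x),$$ the density ratio model is $r_\theta(x;\delta)=\delta^\top T_\theta f(x)+1$, and for sample size $n=n_q$ $$\ell(\delta,\theta)=\frac1n\sum_{i=1}^{n}\log r_\theta(x^{(i)};\delta),\qquad H=\nabla^2_{(\delta,\theta)}\ell(\delta,\theta),$$ with blocks $H_{\delta\delta},H_{\delta\theta},H_{\theta\delta},H_{\theta\theta}$. $E_q[H]$ is the entrywise expectation at fixed $(\delta,\theta)$, i.e. $E_q[H]=\int\nabla^2_{(\delta,\theta)}\log r_\theta(x;\delta)\,q(x)\,dx$, and $H^*$ is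 $H$ evaluated at the true pair $(\delta^*,\theta^*)$ of Assumption 1. For each $n$ let $\Delta_{n}\subset\mathbb R^b$ be a compact convex set, which may depend on the sample. "With high probability" means with probability tending to $1$ as $n\to\infty$. $\lambda_{\min}$ is the smallest eigenvalue and $\|\cdot\|$ is the spectral norm. **Regularity.** For all $\theta\in\Theta$: $p(\cdot;\theta)$ is $C^1$ and $f$ is $C^2$; for all $i,j$, $p(x;\theta)\,\partial_{x_j}f_i(x)\to0$ as $|x_j|\to\infty$ with the other coordinates fixed; and $\partial_{x_j}\!\big(p(x;\theta)\,\partial_{x_j}f_i(x)\big)$ is Lebesgue integrable. For every $x$ the map $\theta\mapsto T_\theta f(x)$ is defined and $C^2$ on a fixed open neighbourhood of $\Theta$. With high probability $r_\theta(x^{(i)};\delta)>0$ for all $i\le n$, $\theta\in\Theta$, $\delta\in\Delta_n$. **Estimator.** $(\hat\delta,\hat\theta)$ is a measurable function of the underlying outcome with values in $\Delta_n\times\Theta$ which, with high probability, solves $\min_{\theta\in\Theta}\max_{\delta\in\Delta_n}\ell(\delta,\theta)$ and lies in the interior of $\Delta_n\times\Theta$. **Assumption 1 (correct model).** There is a unique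 pair $(\theta^*,\delta^*)$ with $\theta^*\in\Theta$ and $\delta^*\in\Delta_n$ (for every $n$ and every sample) such that $p(\cdot;\theta^*)\equiv q$ and $r_{\theta^*}(\cdot;\delta^*)\equiv1$. Moreover the Stein features identify $\theta^*$: if $\theta\in\Theta$ and $E_q[T_\theta f(x)]=0$, then $\theta=\theta^*$. **Assumption 2.** There are constants $\Lambda'_{\min},\Lambda_{\max},\Lambda_{\min}>0$, independent of $n$, such that with high probability, for all $\theta\in\Theta$ and $\delta\in\Delta_n$, $$\lambda_{\min}\{-H_{\delta\delta}\}\ge\Lambda'_{\min},\quad \|H_{\theta\delta}H_{\delta\delta}^{-1}\|\le\Lambda_{\max},\quad \lambda_{\min}\{-H_{\theta\delta}H_{\delta\delta}^{-1}H_{\delta\theta}\}\ge\Lambda_{\min}>2\|H_{\theta\theta}\|.$$ **Assumption 3.** $T_{\theta^*}f$ is $Q$-integrable and $\big\|\frac1n\sum_{i=1}^nT_{\theta^*}f(x^{(i)})-E_q[T_{\theta^*}f(x)]\big\|\to0$ in probability. **Assumption 4.** The expectation $E_q[H]$ exists at all points of $\Delta_n\times\Theta$ (for all $n$ and all samples)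 and is continuous on the union of these sets, and $\sup_{\delta\in\Delta_n,\theta\in\Theta}|H_{ij}-E_q[H_{ij}]|\to0$ in (outer) probability for all $i,j$. **Theorem.** Suppose in addition that $E_q[H^*_{\delta\delta}]$ is invertible, that $E_q[H^*_{\delta\theta}]\in\mathbb R^{b\times k}$ has full rank, and that $\dim(\theta)=k<b$. Then, as $n=n_q\to\infty$, $$2n_q\,\ell(\hat\delta,\hat\theta)\rightsquigarrow\chi^2\big(b-\dim(\theta)\big).$$ -/

import Mathlib

open MeasureTheory ProbabilityTheory Filter Topology
open scoped ENNReal Matrix Matrix.Norms.L2Operator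

namespace DLE

noncomputable section

/-- Euclidean space of dimension `m`. -/
abbrev Vec (m : ℕ) : Type := EuclideanSpace ℝ (Fin m)

/-- The partial derivative of `g` in the `j`-th coordinate direction. -/
def partialDeriv {m : ℕ} (j : Fin m) (g : Vec m → ℝ) (x : Vec m) : ℝ :=
  fderiv ℝ g x (EuclideanSpace.single j 1)

/-- The Stein operator of a density `p` on a scalar function `g`:
`⟨∇ log p, ∇ g⟩ + trace (∇² g)`. -/
def steinOp {d : ℕ} (p : Vec d → ℝ) (g : Vec d → ℝ) (x : Vec d) : ℝ :=
  inner ℝ (gradient (fun y => Real.log (p y)) x) (gradient g x)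
    + ∑ j : Fin d, partialDeriv j (partialDeriv j g) x

/-- The Stein feature: the Stein operator applied to each output of `f`. -/
def steinFeature {d b : ℕ} (p : Vec d → ℝ) (f : Vec d → Vec b) (x : Vec d) : Vec b :=
  WithLp.toLp 2 fun i => steinOp p (fun y => f y i) x

/-- The density ratio model `r_θ(x; δ) = δᵀ T_θ f(x) + 1`. -/
def ratio {d b k : ℕ} (p : Vec k → Vec d → ℝ) (f : Vec d → Vec b)
    (θ : Vec k) (x : Vec d) (δ : Vec b) : ℝ :=
  inner ℝ δ (steinFeature (p θ) f x) + 1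

/-- The log ratio of one observation as a function of the pair `(δ, θ)`. -/
def logRatio {d b k : ℕ} (p : Vec k → Vec d → ℝ) (f : Vec d → Vec b) (x : Vec d)
    (η : Vec b × Vec k) : ℝ :=
  Real.log (ratio p f η.2 x η.1)

/-- The objective `ℓ(δ, θ) = (1/n) ∑_{i<n} log r_θ(x_i; δ)` as a function of the pair `(δ, θ)`. -/
def objective {d b k : ℕ} (p : Vec k → Vec d → ℝ) (f : Vec d → Vec b) (n : ℕ)
    (x : ℕ → Vec d) (η : Vec b × Vec k) : ℝ :=
  (n : ℝ)⁻¹ * ∑ i ∈ Finset.range n, logRatio p f (x i) η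

/-- The coordinate directions of the joint parameter `(δ, θ)`. -/
def coordVec {b k : ℕ} : Fin b ⊕ Fin k → Vec b × Vec k
  | Sum.inl i => (EuclideanSpace.single i 1, 0)
  | Sum.inr j => (0, EuclideanSpace.single j 1)

/-- The Hessian matrix in `(δ, θ)`. Its blocks `toBlocks₁₁`, `toBlocks₁₂`, `toBlocks₂₁`,
`toBlocks₂₂` are the `δδ`, `δθ`, `θδ` and `θθ` blocks. -/
def hessian {b k : ℕ} (F : Vec b × Vec k → ℝ) (η : Vec b × Vec k) :
    Matrix (Fin b ⊕ Fin k) (Fin b ⊕ Fin k) ℝ :=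
  fun i j => fderiv ℝ (fun η' => fderiv ℝ F η' (coordVec j)) η (coordVec i)

/-- The entrywise expectation `E_q[H]` of the Hessian at `η`. The sample Hessian is an average over
identically distributed observations, so this is the mean over a single observation. -/
def meanHessian {d b k : ℕ} (p : Vec k → Vec d → ℝ) (f : Vec d → Vec b) (Q : Measure (Vec d))
    (η : Vec b × Vec k) : Matrix (Fin b ⊕ Fin k) (Fin b ⊕ Fin k) ℝ :=
  fun i j => ∫ x, hessian (logRatio p f x) η i j ∂Q

/-- The event `A n` holds with probability tending to one (in outer probability, so that no
measurability of `A n` is needed). -/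
def HighProb {Ω : Type*} [MeasurableSpace Ω] (μ : Measure Ω) (A : ℕ → Ω → Prop) : Prop :=
  Tendsto (fun n => μ {ω | ¬ A n ω}) atTop (𝓝 0)

/-- `p` is a strictly positive probability density. -/
structure IsPosDensity {d : ℕ} (p : Vec d → ℝ) : Prop where
  pos : ∀ x, 0 < p x
  mass : ∫⁻ x, ENNReal.ofReal (p x) = 1

/-- The regularity conditions of Stein's identity: smoothness, vanishing of `p ∂ⱼ fᵢ` as the `j`-th
coordinate tends to `±∞`, and integrability of the terms `∂ⱼ (p ∂ⱼ fᵢ)`. -/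
structure SteinRegular {d b : ℕ} (p : Vec d → ℝ) (f : Vec d → Vec b) : Prop where
  density_smooth : ContDiff ℝ 1 p
  feature_smooth : ContDiff ℝ 2 f
  decay : ∀ (i : Fin b) (j : Fin d) (x : Vec d),
    Tendsto (fun t : ℝ => p (x + t • EuclideanSpace.single j 1)
        * partialDeriv j (fun y => f y i) (x + t • EuclideanSpace.single j 1))
      (cocompact ℝ) (𝓝 0)
  integrable : ∀ (i : Fin b) (j : Fin d),
    Integrable (partialDeriv j fun y => p y * partialDeriv j (fun z => f z i) y)

/-- `(θs, δs)` is the unique pair in `Θ × Δ` such that `p_θs ≡ q` and `r_θs(·; δs) ≡ 1`; here `Δ` may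
depend on the sample size and on the sample. -/
structure CorrectModel {Ω : Type*} {d b k : ℕ} (p : Vec k → Vec d → ℝ) (f : Vec d → Vec b)
    (q : Vec d → ℝ) (Θ : Set (Vec k)) (Δ : ℕ → Ω → Set (Vec b)) (θs : Vec k) (δs : Vec b) :
    Prop where
  mem_param : θs ∈ Θ
  mem_ratio : ∀ n ω, δs ∈ Δ n ω
  density_eq : ∀ x, p θs x = q x
  ratio_eq : ∀ x, ratio p f θs x δs = 1
  unique : ∀ n ω, ∀ θ ∈ Θ, ∀ δ ∈ Δ n ω,
    (∀ x, p θ x = q x) → (∀ x, ratio p f θ x δ = 1) → θ = θs ∧ δ = δs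

/-- The bounds on the blocks of a Hessian `H` with constants `Λ'`, `Λmax`, `Λmin`:
`λ_min(-H_δδ) ≥ Λ'`, `‖H_θδ H_δδ⁻¹‖ ≤ Λmax` and
`λ_min(-H_θδ H_δδ⁻¹ H_δθ) ≥ Λmin > 2 ‖H_θθ‖`, with spectral norms. The bound `λ_min(A) ≥ c` for a
symmetric matrix `A` is expressed by `A - c • 1` being positive semidefinite. -/
structure HessianBounds {b k : ℕ} (Λ' Λmax Λmin : ℝ)
    (H : Matrix (Fin b ⊕ Fin k) (Fin b ⊕ Fin k) ℝ) : Prop where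
  ratio_block : (-H.toBlocks₁₁ - Λ' • (1 : Matrix (Fin b) (Fin b) ℝ)).PosSemidef
  cross_block : ‖H.toBlocks₂₁ * H.toBlocks₁₁⁻¹‖ ≤ Λmax
  schur_block : (-(H.toBlocks₂₁ * H.toBlocks₁₁⁻¹ * H.toBlocks₁₂)
    - Λmin • (1 : Matrix (Fin k) (Fin k) ℝ)).PosSemidef
  param_block : 2 * ‖H.toBlocks₂₂‖ < Λmin

/-- With probability tending to one the bounds hold on all of `Δₙ × Θ`, with fixed positive
constants. -/
def UniformHessianBounds {Ω : Type*} [MeasurableSpace Ω] (μ : Measure Ω) {d b k : ℕ}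
    (p : Vec k → Vec d → ℝ) (f : Vec d → Vec b) (X : ℕ → Ω → Vec d)
    (Θ : Set (Vec k)) (Δ : ℕ → Ω → Set (Vec b)) : Prop :=
  ∃ Λ' Λmax Λmin : ℝ, 0 < Λ' ∧ 0 < Λmax ∧ 0 < Λmin ∧
    HighProb μ fun n ω => ∀ δ ∈ Δ n ω, ∀ θ ∈ Θ,
      HessianBounds Λ' Λmax Λmin (hessian (objective p f n fun i => X i ω) (δ, θ))

/-- Concentration of the Stein features at `θs`: their sample mean converges in probability to
their expectation. -/
structure SteinConcentration {Ω : Type*} [MeasurableSpace Ω] (μ : Measure Ω) {d b k : ℕ}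
    (p : Vec k → Vec d → ℝ) (f : Vec d → Vec b) (Q : Measure (Vec d)) (X : ℕ → Ω → Vec d)
    (θs : Vec k) : Prop where
  integrable : Integrable (steinFeature (p θs) f) Q
  tendsto : TendstoInMeasure μ
    (fun (n : ℕ) ω => ‖(n : ℝ)⁻¹ • ∑ i ∈ Finset.range n, steinFeature (p θs) f (X i ω)
      - ∫ x, steinFeature (p θs) f x ∂Q‖) atTop (fun _ => (0 : ℝ))

/-- Uniform convergence of the Hessian: on `Δₙ × Θ` the expected Hessian exists and is continuous,
and `sup |H_ij - E_q[H_ij]|` over `Δₙ × Θ` tends to zero in probability for all `i, j`. -/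
structure UniformHessianConvergence {Ω : Type*} [MeasurableSpace Ω] (μ : Measure Ω) {d b k : ℕ}
    (p : Vec k → Vec d → ℝ) (f : Vec d → Vec b) (Q : Measure (Vec d)) (X : ℕ → Ω → Vec d)
    (Θ : Set (Vec k)) (Δ : ℕ → Ω → Set (Vec b)) : Prop where
  integrable : ∀ n ω, ∀ δ ∈ Δ n ω, ∀ θ ∈ Θ, ∀ i j,
    Integrable (fun x => hessian (logRatio p f x) (δ, θ) i j) Q
  continuousOn : ∀ i j, ContinuousOn (fun η => meanHessian p f Q η i j) ((⋃ n, ⋃ ω, Δ n ω) ×ˢ Θ)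
  tendsto : ∀ i j, ∀ ε : ℝ, 0 < ε → HighProb μ fun n ω => ∀ δ ∈ Δ n ω, ∀ θ ∈ Θ,
    |hessian (objective p f n fun i => X i ω) (δ, θ) i j - meanHessian p f Q (δ, θ) i j| ≤ ε

/-- `(δ, θ)` solves `min_{θ' ∈ Θ} max_{δ' ∈ Δ} F (δ', θ')`, and the constraints are not active at
the solution. -/
structure IsInteriorMinMax {b k : ℕ} (F : Vec b × Vec k → ℝ) (Δ : Set (Vec b)) (Θ : Set (Vec k))
    (δ : Vec b) (θ : Vec k) : Prop where
  mem_interior_ratio : δ ∈ interior Δ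
  mem_interior_param : θ ∈ interior Θ
  max : ∀ δ' ∈ Δ, F (δ', θ) ≤ F (δ, θ)
  min : ∀ θ' ∈ Θ, ∃ δ' ∈ Δ, F (δ, θ) ≤ F (δ', θ')

/-- The chi-squared distribution with `m` degrees of freedom: the law of the sum of the squares of
`m` independent standard normal variables. -/
def chiSquared (m : ℕ) : Measure ℝ :=
  (Measure.pi fun _ : Fin m => gaussianReal 0 1).map fun z => ∑ i, z i ^ 2

instance (m : ℕ) : IsProbabilityMeasure (chiSquared m) :=
  Measure.isProbabilityMeasure_map
    (Finset.measurable_sum _ fun i _ => (measurable_pi_apply i).pow_const 2).aemeasurable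

end

end DLE

/-! The statistic is the value of a saddle point problem that is asymptotically quadratic, and that
value is a sum of `b - k` squared standard normals.

The condition that the ratio is identically one at the true pair says that the inner product of `δs`
with the Stein feature `T` vanishes everywhere; since the second moment matrix `S` of `T` is
invertible, `δs = 0`. The log ratio vanishes identically on the slice `δ = 0`, so at `(0, θs)` the
gradient of the objective is `(s, 0)`, with `s` the sample mean of `T`, and the mean Hessian is the
saddle matrix with blocks `-S`, `D`, `Dᵀ`, `0` (`meanHessian_eq_saddleMatrix`). Stein's identity
gives `T` mean zero under `Q`.

At the estimator the full gradient vanishes (`IsInteriorMinMax.fderiv_eq_zero`). The estimator is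
consistent (`highProb_estimator_near`): strong concavity bounds `δhat` by a multiple of the norm of
`s`; the sample Stein mean at `θhat` is then small, while identification keeps it away from zero
outside any neighbourhood of `θs`. Hence the displacement `z` from `(0, θs)` nearly solves the
saddle system with right side `(-s, 0)`, and the objective is nearly `-1/2` times its quadratic form
at `z`, with errors relative to `z` (`highProb_objective_expansion`). No rate of convergence has to
be known beforehand.

For the exact system, twice the value is the sum of `(e i ⬝ᵥ s) ^ 2` over an `S`-orthonormal basis
`e` of the kernel of `Dᵀ`, which has dimension `b - k`; `exists_abs_sub_sum_sq_le` shows that this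
is stable under relative errors. After multiplication by `n` the error is an arbitrarily small
multiple of `n * ‖s‖ ^ 2`, which is tight by Chebyshev, and the main term is a sum of squares to
which the central limit theorem with identity covariance applies. Slutsky's lemma concludes. -/

namespace DLE

/-! ### Second order calculus in the joint parameter and first order conditions for min-max points.
-/

section Calculus

variable {b k : ℕ}

/-- The coordinates of a joint parameter `(δ, θ)`. -/
def jointCoord (z : Vec b × Vec k) : Fin b ⊕ Fin k → ℝ :=
  Sum.elim (fun i => z.1 i) (fun j => z.2 j)

theorem sum_jointCoord_smul_coordVec (z : Vec b × Vec k) :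
    ∑ i, jointCoord z i • (coordVec i : Vec b × Vec k) = z := by
  rw [Fintype.sum_sum_type]
  ext i <;> simp [jointCoord, coordVec, Prod.fst_sum, Prod.snd_sum, Pi.single_apply]

theorem map_eq_sum_jointCoord (L : Vec b × Vec k →L[ℝ] ℝ) (z : Vec b × Vec k) :
    L z = ∑ i, jointCoord z i * L (coordVec i) := by
  conv_lhs => rw [← sum_jointCoord_smul_coordVec z]
  simp

variable {F : Vec b × Vec k → ℝ}

theorem hasFDerivAt_fderiv_apply {η : Vec b × Vec k} (hF : ContDiffAt ℝ 2 F η)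
    (v : Vec b × Vec k) :
    HasFDerivAt (fun η' => fderiv ℝ F η' v) ((fderiv ℝ (fderiv ℝ F) η).flip v) η := by
  have h : DifferentiableAt ℝ (fderiv ℝ F) η :=
    (hF.fderiv_right (m := 1) (by norm_num)).differentiableAt (by norm_num)
  exact (h.hasFDerivAt.clm_apply (hasFDerivAt_const v η)).congr_fderiv (by ext <;> simp)

theorem hessian_eq {η : Vec b × Vec k} (hF : ContDiffAt ℝ 2 F η) (i j : Fin b ⊕ Fin k) :
    hessian F η i j = fderiv ℝ (fderiv ℝ F) η (coordVec i) (coordVec j) := by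
  rw [hessian, (hasFDerivAt_fderiv_apply hF _).fderiv]
  rfl

theorem hessian_symm {η : Vec b × Vec k} (hF : ContDiffAt ℝ 2 F η) (i j : Fin b ⊕ Fin k) :
    hessian F η i j = hessian F η j i := by
  rw [hessian_eq hF, hessian_eq hF]
  exact (hF.isSymmSndFDerivAt (by simp)).eq _ _

theorem hasDerivAt_fderiv_line {a z : Vec b × Vec k} {t : ℝ}
    (hF : ContDiffAt ℝ 2 F (a + t • z)) (j : Fin b ⊕ Fin k) :
    HasDerivAt (fun s : ℝ => fderiv ℝ F (a + s • z) (coordVec j))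
      (∑ i, jointCoord z i * hessian F (a + t • z) i j) t := by
  have h1 : HasDerivAt (fun s : ℝ => a + s • z) z t := by
    simpa using ((hasDerivAt_id t).smul_const z).const_add a
  have h2 := (hasFDerivAt_fderiv_apply hF (coordVec j)).comp_hasDerivAt t h1
  refine h2.congr_deriv ?_
  rw [map_eq_sum_jointCoord]
  exact Finset.sum_congr rfl fun i _ => by rw [hessian_eq hF]; rfl

theorem hasDerivAt_line {a z : Vec b × Vec k} {t : ℝ} (hF : ContDiffAt ℝ 2 F (a + t • z)) :
    HasDerivAt (fun s : ℝ => F (a + s • z))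
      (∑ j, jointCoord z j * fderiv ℝ F (a + t • z) (coordVec j)) t := by
  have h1 : HasDerivAt (fun s : ℝ => a + s • z) z t := by
    simpa using ((hasDerivAt_id t).smul_const z).const_add a
  have h2 := (hF.differentiableAt (by norm_num)).hasFDerivAt.comp_hasDerivAt t h1
  exact h2.congr_deriv (map_eq_sum_jointCoord _ _)

/-- The gradient along a line on which the Hessian is entrywise close to `M`. -/
theorem abs_fderiv_line_sub_le {a z : Vec b × Vec k} {M : Matrix (Fin b ⊕ Fin k) (Fin b ⊕ Fin k) ℝ}
    {ε : ℝ} (hF : ∀ t ∈ Set.Icc (0 : ℝ) 1, ContDiffAt ℝ 2 F (a + t • z))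
    (hM : ∀ t ∈ Set.Icc (0 : ℝ) 1, ∀ i j, |hessian F (a + t • z) i j - M i j| ≤ ε)
    (j : Fin b ⊕ Fin k) {s t : ℝ} (hs : 0 ≤ s) (hst : s ≤ t) (ht : t ≤ 1) :
    |fderiv ℝ F (a + t • z) (coordVec j) - fderiv ℝ F (a + s • z) (coordVec j)
      - (t - s) * ∑ i, jointCoord z i * M i j| ≤ (t - s) * (ε * ∑ i, |jointCoord z i|) := by
  have hd : ∀ r ∈ Set.Icc s t, HasDerivWithinAt
      (fun r : ℝ => fderiv ℝ F (a + r • z) (coordVec j) - r * ∑ i, jointCoord z i * M i j)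
      (∑ i, jointCoord z i * hessian F (a + r • z) i j - ∑ i, jointCoord z i * M i j)
      (Set.Icc s t) r := fun r hr => by
    have h := (hasDerivAt_fderiv_line (hF r ⟨hs.trans hr.1, hr.2.trans ht⟩) j).fun_sub
      ((hasDerivAt_id r).mul_const (∑ i, jointCoord z i * M i j))
    simpa using h.hasDerivWithinAt
  have hb : ∀ r ∈ Set.Ico s t,
      ‖∑ i, jointCoord z i * hessian F (a + r • z) i j - ∑ i, jointCoord z i * M i j‖
        ≤ ε * ∑ i, |jointCoord z i| := fun r hr => by
    rw [← Finset.sum_sub_distrib, Finset.mul_sum, Real.norm_eq_abs]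
    refine (Finset.abs_sum_le_sum_abs _ _).trans (Finset.sum_le_sum fun i _ => ?_)
    rw [← mul_sub, abs_mul, mul_comm]
    exact mul_le_mul_of_nonneg_right (hM r ⟨hs.trans hr.1, hr.2.le.trans ht⟩ i j) (abs_nonneg _)
  have := norm_image_sub_le_of_norm_deriv_le_segment' hd hb t ⟨hst, le_rfl⟩
  rw [Real.norm_eq_abs] at this
  calc _ = _ := by congr 1; ring
    _ ≤ _ := this
    _ = _ := by ring

theorem abs_fderiv_sub_le {a c : Vec b × Vec k} {M : Matrix (Fin b ⊕ Fin k) (Fin b ⊕ Fin k) ℝ}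
    {ε : ℝ} (hF : ∀ t ∈ Set.Icc (0 : ℝ) 1, ContDiffAt ℝ 2 F (a + t • (c - a)))
    (hM : ∀ t ∈ Set.Icc (0 : ℝ) 1, ∀ i j, |hessian F (a + t • (c - a)) i j - M i j| ≤ ε)
    (j : Fin b ⊕ Fin k) :
    |fderiv ℝ F c (coordVec j) - fderiv ℝ F a (coordVec j)
      - ∑ i, jointCoord (c - a) i * M i j| ≤ ε * ∑ i, |jointCoord (c - a) i| := by
  simpa using abs_fderiv_line_sub_le hF hM j le_rfl zero_le_one le_rfl

/-- Second order expansion around a critical point `c`. -/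
theorem abs_sub_add_half_quadratic_le {a c : Vec b × Vec k}
    {M : Matrix (Fin b ⊕ Fin k) (Fin b ⊕ Fin k) ℝ} {ε : ℝ}
    (hF : ∀ t ∈ Set.Icc (0 : ℝ) 1, ContDiffAt ℝ 2 F (a + t • (c - a)))
    (hM : ∀ t ∈ Set.Icc (0 : ℝ) 1, ∀ i j, |hessian F (a + t • (c - a)) i j - M i j| ≤ ε)
    (hc : ∀ j, fderiv ℝ F c (coordVec j) = 0) :
    |F c - F a + 2⁻¹ * ∑ j, (∑ i, jointCoord (c - a) i * M i j) * jointCoord (c - a) j|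
      ≤ ε * (∑ i, |jointCoord (c - a) i|) ^ 2 := by
  set z := c - a with hz
  set q := ∑ j, (∑ i, jointCoord z i * M i j) * jointCoord z j with hq
  -- The sign of `ε` follows from `hM` as soon as there is an index; without indices the sum is
  -- empty.
  have hε : 0 ≤ ε * ∑ i, |jointCoord z i| := by
    by_cases h : Nonempty (Fin b ⊕ Fin k)
    · obtain ⟨i⟩ := h
      exact mul_nonneg ((abs_nonneg _).trans (hM 0 (by simp) i i))
        (Finset.sum_nonneg fun _ _ => abs_nonneg _)
    · have := not_nonempty_iff.1 h
      simp
  -- Expanding backwards from `c`, where the gradient vanishes, the derivative of `F` along the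
  -- segment should be close to `-(1 - r) * q`; the subtracted term is the corresponding
  -- antiderivative.
  have hd : ∀ r ∈ Set.Icc (0 : ℝ) 1, HasDerivWithinAt
      (fun r : ℝ => F (a + r • z) - 2⁻¹ * (1 - r) ^ 2 * q)
      (∑ j, jointCoord z j * fderiv ℝ F (a + r • z) (coordVec j) + (1 - r) * q)
      (Set.Icc 0 1) r := fun r hr => by
    have h1 : HasDerivAt (fun r : ℝ => 2⁻¹ * (1 - r) ^ 2 * q) (-((1 - r) * q)) r := by
      have := ((((hasDerivAt_id r).const_sub 1).pow 2).const_mul (2⁻¹ : ℝ)).mul_const q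
      refine this.congr_deriv ?_
      simp
      ring
    have h := (hasDerivAt_line (hF r hr)).fun_sub h1
    simpa using h.hasDerivWithinAt
  have hb : ∀ r ∈ Set.Ico (0 : ℝ) 1,
      ‖∑ j, jointCoord z j * fderiv ℝ F (a + r • z) (coordVec j) + (1 - r) * q‖
        ≤ ε * (∑ i, |jointCoord z i|) ^ 2 := fun r hr => by
    rw [hq, Finset.mul_sum, ← Finset.sum_add_distrib, Real.norm_eq_abs, pow_two, ← mul_assoc,
      Finset.mul_sum]
    refine (Finset.abs_sum_le_sum_abs _ _).trans (Finset.sum_le_sum fun j _ => ?_)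
    have h := abs_fderiv_line_sub_le hF hM j hr.1 hr.2.le le_rfl
    have hc' : fderiv ℝ F (a + (1 : ℝ) • z) (coordVec j) = 0 := by rw [hz]; simpa using hc j
    rw [hc'] at h
    have e : jointCoord z j * fderiv ℝ F (a + r • z) (coordVec j)
        + (1 - r) * ((∑ i, jointCoord z i * M i j) * jointCoord z j)
        = -(0 - fderiv ℝ F (a + r • z) (coordVec j) - (1 - r) * ∑ i, jointCoord z i * M i j)
          * jointCoord z j := by ring
    rw [e, abs_mul, abs_neg]
    refine mul_le_mul_of_nonneg_right (h.trans ?_) (abs_nonneg _)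
    exact mul_le_of_le_one_left hε (by linarith [hr.1])
  have := norm_image_sub_le_of_norm_deriv_le_segment' hd hb 1 ⟨zero_le_one, le_rfl⟩
  rw [Real.norm_eq_abs] at this
  calc _ = _ := by congr 1; simp [hz]; ring
    _ ≤ _ := this
    _ = _ := by ring

/-- Two monotonicity arguments in place of Taylor's formula: `φ' t + c * t` is antitone, hence so is
`φ t + c / 2 * t ^ 2 - φ' 0 * t`; compare the endpoints. -/
theorem le_of_second_deriv_le {φ φ' φ'' : ℝ → ℝ} {c : ℝ}
    (h1 : ∀ t ∈ Set.Icc (0 : ℝ) 1, HasDerivAt φ (φ' t) t)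
    (h2 : ∀ t ∈ Set.Icc (0 : ℝ) 1, HasDerivAt φ' (φ'' t) t)
    (h3 : ∀ t ∈ Set.Icc (0 : ℝ) 1, φ'' t ≤ -c) : φ 1 ≤ φ 0 + φ' 0 - c / 2 := by
  have m1 : AntitoneOn (fun t => φ' t + c * t) (Set.Icc 0 1) := by
    have hd : ∀ t ∈ Set.Icc (0 : ℝ) 1, HasDerivAt (fun t => φ' t + c * t) (φ'' t + c) t :=
      fun t ht => by simpa using (h2 t ht).fun_add ((hasDerivAt_id t).const_mul c)
    refine antitoneOn_of_deriv_nonpos (convex_Icc 0 1)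
      (fun t ht => (hd t ht).continuousAt.continuousWithinAt)
      (fun t ht => (hd t (interior_subset ht)).differentiableAt.differentiableWithinAt)
      fun t ht => ?_
    rw [(hd t (interior_subset ht)).deriv]
    linarith [h3 t (interior_subset ht)]
  have m2 : AntitoneOn (fun t => φ t + c / 2 * t ^ 2 - φ' 0 * t) (Set.Icc 0 1) := by
    have hd : ∀ t ∈ Set.Icc (0 : ℝ) 1,
        HasDerivAt (fun t => φ t + c / 2 * t ^ 2 - φ' 0 * t) (φ' t + c * t - φ' 0) t :=
      fun t ht => by
        have := ((h1 t ht).add (((hasDerivAt_id t).pow 2).const_mul (c / 2))).sub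
          ((hasDerivAt_id t).const_mul (φ' 0))
        refine this.congr_deriv ?_
        simp
        ring
    refine antitoneOn_of_deriv_nonpos (convex_Icc 0 1)
      (fun t ht => (hd t ht).continuousAt.continuousWithinAt)
      (fun t ht => (hd t (interior_subset ht)).differentiableAt.differentiableWithinAt)
      fun t ht => ?_
    have ht' := interior_subset ht
    rw [(hd t ht').deriv]
    have := m1 (Set.left_mem_Icc.2 zero_le_one) ht' ht'.1
    simp only at this
    linarith
  have := m2 (Set.left_mem_Icc.2 zero_le_one) (Set.right_mem_Icc.2 zero_le_one) zero_le_one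
  simp only at this
  linarith

theorem quadratic_le_of_posSemidef {H : Matrix (Fin b ⊕ Fin k) (Fin b ⊕ Fin k) ℝ} {c : ℝ}
    (hH : (-H.toBlocks₁₁ - c • (1 : Matrix (Fin b) (Fin b) ℝ)).PosSemidef) (u : Vec b) :
    ∑ j, jointCoord ((u, 0) : Vec b × Vec k) j
      * ∑ i, jointCoord ((u, 0) : Vec b × Vec k) i * H i j ≤ -(c * ‖u‖ ^ 2) := by
  have h := hH.dotProduct_mulVec_nonneg (fun i => u i)
  have e : (∑ j, jointCoord ((u, 0) : Vec b × Vec k) j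
      * ∑ i, jointCoord ((u, 0) : Vec b × Vec k) i * H i j)
      = (fun i => u i) ⬝ᵥ H.toBlocks₁₁ *ᵥ (fun i => u i) := by
    simp only [jointCoord, Fintype.sum_sum_type, Sum.elim_inl, Sum.elim_inr, PiLp.zero_apply,
      zero_mul, Finset.sum_const_zero, add_zero, dotProduct, Matrix.mulVec, Matrix.toBlocks₁₁,
      Matrix.of_apply, Finset.mul_sum]
    rw [Finset.sum_comm]
    exact Finset.sum_congr rfl fun i _ => Finset.sum_congr rfl fun j _ => by ring
  have n : ‖u‖ ^ 2 = (fun i => u i) ⬝ᵥ (fun i => u i) := by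
    rw [EuclideanSpace.norm_sq_eq]
    simp [dotProduct, pow_two]
  rw [e, n]
  simp only [star_trivial, Matrix.sub_mulVec, Matrix.neg_mulVec, Matrix.smul_mulVec,
    Matrix.one_mulVec, dotProduct_sub, dotProduct_neg, dotProduct_smul, smul_eq_mul] at h
  linarith

/-- Strong concavity in the first variable. -/
theorem le_sub_of_posSemidef {Δ : Set (Vec b)} (hΔ : Convex ℝ Δ) {θ : Vec k} {c : ℝ}
    (hF : ∀ δ ∈ Δ, ContDiffAt ℝ 2 F (δ, θ))
    (hH : ∀ δ ∈ Δ, (-(hessian F (δ, θ)).toBlocks₁₁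
      - c • (1 : Matrix (Fin b) (Fin b) ℝ)).PosSemidef)
    {δ₀ δ₁ : Vec b} (h₀ : δ₀ ∈ Δ) (h₁ : δ₁ ∈ Δ) :
    F (δ₁, θ) ≤ F (δ₀, θ) + fderiv ℝ F (δ₀, θ) (δ₁ - δ₀, 0) - c / 2 * ‖δ₁ - δ₀‖ ^ 2 := by
  set z : Vec b × Vec k := (δ₁ - δ₀, 0) with hz
  have hseg : ∀ t ∈ Set.Icc (0 : ℝ) 1, δ₀ + t • (δ₁ - δ₀) ∈ Δ := fun t ht =>
    hΔ.add_smul_sub_mem h₀ h₁ ht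
  have hline : ∀ t : ℝ, ((δ₀, θ) : Vec b × Vec k) + t • z = (δ₀ + t • (δ₁ - δ₀), θ) := fun t => by
    simp [hz]
  have hC : ∀ t ∈ Set.Icc (0 : ℝ) 1, ContDiffAt ℝ 2 F (((δ₀, θ) : Vec b × Vec k) + t • z) :=
    fun t ht => by rw [hline]; exact hF _ (hseg t ht)
  have := le_of_second_deriv_le (c := c * ‖δ₁ - δ₀‖ ^ 2)
    (fun t ht => hasDerivAt_line (hC t ht))
    (fun t ht => HasDerivAt.fun_sum fun j _ =>
      (hasDerivAt_fderiv_line (hC t ht) j).const_mul (jointCoord z j))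
    (fun t ht => by
      refine quadratic_le_of_posSemidef ?_ _
      rw [hline]; exact hH _ (hseg t ht))
  simp only [zero_smul, add_zero, one_smul, ← map_eq_sum_jointCoord] at this
  rw [hz] at this
  simp only [Prod.mk_add_mk, add_sub_cancel, add_zero] at this
  calc _ ≤ _ := this
    _ = _ := by ring

/-- Completing the square coordinatewise. Together with strong concavity it bounds the gain from
maximizing over `δ` by the squared `δ`-gradient. -/
theorem apply_sub_half_norm_sq_le (L : Vec b × Vec k →L[ℝ] ℝ) {c : ℝ} (hc : 0 < c) (u : Vec b) :
    L (u, 0) - c / 2 * ‖u‖ ^ 2 ≤ (∑ j, L (coordVec (Sum.inl j)) ^ 2) / (2 * c) := by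
  rw [map_eq_sum_jointCoord, EuclideanSpace.norm_sq_eq, Fintype.sum_sum_type, Finset.sum_div,
    Finset.mul_sum]
  simp only [jointCoord, Sum.elim_inl, Sum.elim_inr, PiLp.zero_apply, zero_mul,
    Finset.sum_const_zero, add_zero, Real.norm_eq_abs, sq_abs]
  rw [← Finset.sum_sub_distrib]
  refine Finset.sum_le_sum fun j _ => ?_
  rw [le_div_iff₀ (by positivity)]
  nlinarith [sq_nonneg (L (coordVec (Sum.inl j)) - c * u j)]

/-- The full gradient vanishes at an interior solution of the min-max problem. -/
theorem IsInteriorMinMax.fderiv_eq_zero {Δ : Set (Vec b)} {Θ : Set (Vec k)} (hΔ : Convex ℝ Δ)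
    {c : ℝ} (hc : 0 < c) (hF : ∀ δ ∈ Δ, ∀ θ ∈ Θ, ContDiffAt ℝ 2 F (δ, θ))
    (hH : ∀ δ ∈ Δ, ∀ θ ∈ Θ, (-(hessian F (δ, θ)).toBlocks₁₁
      - c • (1 : Matrix (Fin b) (Fin b) ℝ)).PosSemidef)
    {δ : Vec b} {θ : Vec k} (h : IsInteriorMinMax F Δ Θ δ θ) : fderiv ℝ F (δ, θ) = 0 := by
  have hδ : δ ∈ Δ := interior_subset h.mem_interior_ratio
  have hθ : θ ∈ Θ := interior_subset h.mem_interior_param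
  have hD : ∀ z : Vec b × Vec k, HasDerivAt (fun t : ℝ => F ((δ, θ) + t • z))
      (fderiv ℝ F (δ, θ) z) 0 := fun z => by
    have h0 : ContDiffAt ℝ 2 F ((δ, θ) + (0 : ℝ) • z) := by simpa using hF δ hδ θ hθ
    have := hasDerivAt_line h0
    rwa [← map_eq_sum_jointCoord, zero_smul, add_zero] at this
  have h₁ : ∀ u : Vec b, fderiv ℝ F (δ, θ) (u, 0) = 0 := fun u => by
    refine IsLocalMax.hasDerivAt_eq_zero ?_ (hD (u, 0))
    have hc : Tendsto (fun t : ℝ => δ + t • u) (𝓝 0) (𝓝 δ) := by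
      have : Continuous fun t : ℝ => δ + t • u := by fun_prop
      simpa using this.tendsto 0
    filter_upwards [hc.eventually (mem_interior_iff_mem_nhds.1 h.mem_interior_ratio)] with t ht
    simpa using h.max _ ht
  have h₂ : ∀ w : Vec k, fderiv ℝ F (δ, θ) (0, w) = 0 := fun w => by
    -- An envelope argument that never differentiates the inner maximum. By strong concavity `G t`
    -- dominates the maximum over `Δ` at `θ + t • w`, so `t = 0` is a local minimum of `G`. The
    -- added squares vanish to second order there, so `G` has the derivative of `F` in direction
    -- `w`.
    set G : ℝ → ℝ := fun t => F ((δ, θ) + t • ((0, w) : Vec b × Vec k))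
      + (∑ j, fderiv ℝ F ((δ, θ) + t • ((0, w) : Vec b × Vec k)) (coordVec (Sum.inl j)) ^ 2)
        / (2 * c) with hG
    have h0 : ContDiffAt ℝ 2 F ((δ, θ) + (0 : ℝ) • ((0, w) : Vec b × Vec k)) := by
      simpa using hF δ hδ θ hθ
    have hz : ∀ j, fderiv ℝ F (δ, θ) (coordVec (Sum.inl j)) = 0 := fun j => h₁ _
    have hGd : HasDerivAt G (fderiv ℝ F (δ, θ) (0, w)) 0 := by
      have := (hD (0, w)).fun_add ((HasDerivAt.fun_sum (u := Finset.univ) fun j _ =>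
        (hasDerivAt_fderiv_line h0 (Sum.inl j)).fun_pow 2).div_const (2 * c))
      refine this.congr_deriv ?_
      simp [hz]
    refine IsLocalMin.hasDerivAt_eq_zero ?_ hGd
    have hc' : Tendsto (fun t : ℝ => θ + t • w) (𝓝 0) (𝓝 θ) := by
      have : Continuous fun t : ℝ => θ + t • w := by fun_prop
      simpa using this.tendsto 0
    filter_upwards [hc'.eventually (mem_interior_iff_mem_nhds.1 h.mem_interior_param)] with t ht
    obtain ⟨δ', hδ', hle⟩ := h.min _ ht
    have hsc := le_sub_of_posSemidef hΔ (fun d hd => hF d hd _ ht) (fun d hd => hH d hd _ ht) hδ hδ'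
    have hq := apply_sub_half_norm_sq_le (fderiv ℝ F (δ, θ + t • w)) hc (δ' - δ)
    simp only [hG, zero_smul, add_zero, Prod.smul_mk, smul_zero, Prod.mk_add_mk, hz]
    simp
    linarith
  ext z
  · exact h₁ _
  · exact h₂ _

/-- The first component of a min-max point is bounded by the gradient at `(0, θs)`. -/
theorem IsInteriorMinMax.norm_sq_le {Δ : Set (Vec b)} {Θ : Set (Vec k)} (hΔ : Convex ℝ Δ)
    {c : ℝ} (hc : 0 < c) (hF : ∀ δ ∈ Δ, ∀ θ ∈ Θ, ContDiffAt ℝ 2 F (δ, θ))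
    (hH : ∀ δ ∈ Δ, ∀ θ ∈ Θ, (-(hessian F (δ, θ)).toBlocks₁₁
      - c • (1 : Matrix (Fin b) (Fin b) ℝ)).PosSemidef)
    (h0 : 0 ∈ Δ) (hF0 : ∀ θ ∈ Θ, F (0, θ) = 0) {θs : Vec k} (hθs : θs ∈ Θ)
    {δ : Vec b} {θ : Vec k} (h : IsInteriorMinMax F Δ Θ δ θ) :
    ‖δ‖ ^ 2 ≤ (∑ j, fderiv ℝ F (0, θs) (coordVec (Sum.inl j)) ^ 2) / c ^ 2 := by
  have hδ : δ ∈ Δ := interior_subset h.mem_interior_ratio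
  have hθ : θ ∈ Θ := interior_subset h.mem_interior_param
  obtain ⟨δ', hδ', hle⟩ := h.min θs hθs
  have h1 := le_sub_of_posSemidef hΔ (fun d hd => hF d hd _ hθs) (fun d hd => hH d hd _ hθs) h0 hδ'
  have h2 := apply_sub_half_norm_sq_le (fderiv ℝ F (0, θs)) hc (δ' - 0)
  have h3 := le_sub_of_posSemidef hΔ (fun d hd => hF d hd _ hθ) (fun d hd => hH d hd _ hθ) hδ h0
  -- The value at the solution is squeezed: it is at least `c / 2 * ‖δ‖ ^ 2` by comparison with `0`
  -- at the critical point, and at most the squared gradient at `(0, θs)` over `2 * c`.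
  rw [h.fderiv_eq_zero hΔ hc hF hH, hF0 θ hθ] at h3
  rw [hF0 θs hθs] at h1
  simp only [_root_.zero_apply, zero_sub, norm_neg] at h3
  rw [le_div_iff₀ (by positivity)]
  rw [le_div_iff₀ (by positivity)] at h2
  nlinarith

end Calculus

/-! ### Derivatives of the log ratio and of the objective on the slice `δ = 0`. -/

section Model

variable {d b k : ℕ} {p : Vec k → Vec d → ℝ} {f : Vec d → Vec b} {U : Set (Vec k)} {x : Vec d}

theorem hasDerivAt_fderiv_coordVec {F : Vec b × Vec k → ℝ} {η : Vec b × Vec k}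
    (hF : ContDiffAt ℝ 2 F η) (i j : Fin b ⊕ Fin k) :
    HasDerivAt (fun t : ℝ => fderiv ℝ F (η + t • coordVec i) (coordVec j)) (hessian F η i j) 0 := by
  have h1 : HasDerivAt (fun s : ℝ => η + s • (coordVec i : Vec b × Vec k)) (coordVec i) 0 := by
    simpa using ((hasDerivAt_id (0 : ℝ)).smul_const (coordVec i : Vec b × Vec k)).const_add η
  have h := hasFDerivAt_fderiv_apply hF (coordVec j)
  have h0 : η + (0 : ℝ) • (coordVec i : Vec b × Vec k) = η := by simp
  rw [← h0] at h
  refine (h.comp_hasDerivAt (0 : ℝ) h1).congr_deriv ?_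
  rw [h0, hessian_eq hF]
  rfl

theorem contDiffAt_ratio (hU : IsOpen U)
    (hT : ContDiffOn ℝ 2 (fun θ => steinFeature (p θ) f x) U) {η : Vec b × Vec k} (hη : η.2 ∈ U) :
    ContDiffAt ℝ 2 (fun η : Vec b × Vec k => ratio p f η.2 x η.1) η := by
  have h : ContDiffAt ℝ 2 (fun η : Vec b × Vec k => steinFeature (p η.2) f x) η :=
    (hT.contDiffAt (hU.mem_nhds hη)).comp η contDiffAt_snd
  exact (contDiffAt_fst.inner ℝ h).add contDiffAt_const

theorem contDiffAt_logRatio (hU : IsOpen U)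
    (hT : ContDiffOn ℝ 2 (fun θ => steinFeature (p θ) f x) U) {η : Vec b × Vec k} (hη : η.2 ∈ U)
    (hr : 0 < ratio p f η.2 x η.1) : ContDiffAt ℝ 2 (logRatio p f x) η :=
  (contDiffAt_ratio hU hT hη).log hr.ne'

theorem fderiv_logRatio_apply (hU : IsOpen U)
    (hT : ContDiffOn ℝ 2 (fun θ => steinFeature (p θ) f x) U) {η : Vec b × Vec k} (hη : η.2 ∈ U)
    (hr : 0 < ratio p f η.2 x η.1) (u : Vec b) :
    fderiv ℝ (logRatio p f x) η (u, 0) = inner ℝ u (steinFeature (p η.2) f x)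
      / ratio p f η.2 x η.1 := by
  have h1 := ((contDiffAt_logRatio hU hT hη hr).differentiableAt (by norm_num)).hasFDerivAt
  have h0 : η + (0 : ℝ) • ((u, 0) : Vec b × Vec k) = η := by simp
  have hl : HasDerivAt (fun s : ℝ => η + s • ((u, 0) : Vec b × Vec k)) (u, 0) 0 := by
    simpa using ((hasDerivAt_id (0 : ℝ)).smul_const ((u, 0) : Vec b × Vec k)).const_add η
  rw [← h0] at h1
  have h2 := h1.comp_hasDerivAt (0 : ℝ) hl
  rw [h0] at h2
  have h3 : HasDerivAt (fun s : ℝ => inner ℝ (η.1 + s • u) (steinFeature (p η.2) f x) + 1)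
      (inner ℝ u (steinFeature (p η.2) f x)) 0 := by
    simp only [inner_add_left, real_inner_smul_left]
    simpa using (((hasDerivAt_id (0 : ℝ)).mul_const
      (inner ℝ u (steinFeature (p η.2) f x))).const_add
        (inner ℝ η.1 (steinFeature (p η.2) f x))).add_const 1
  have h4 := h3.log (by simpa [ratio] using hr.ne')
  have h5 : (logRatio p f x ∘ fun s : ℝ => η + s • ((u, 0) : Vec b × Vec k))
      = fun s : ℝ => Real.log (inner ℝ (η.1 + s • u) (steinFeature (p η.2) f x) + 1) := by
    ext s
    simp [logRatio, ratio]
  rw [h5] at h2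
  simpa [ratio] using h2.unique h4

theorem ratio_zero (θ : Vec k) : ratio p f θ x 0 = 1 := by simp [ratio]

theorem logRatio_zero (θ : Vec k) : logRatio p f x (0, θ) = 0 := by simp [logRatio, ratio]

theorem fderiv_apply_snd_eq_zero {F : Vec b × Vec k → ℝ} {θ : Vec k}
    (hF : DifferentiableAt ℝ F (0, θ)) (h0 : ∀ᶠ θ' in 𝓝 θ, F (0, θ') = 0) (w : Vec k) :
    fderiv ℝ F (0, θ) (0, w) = 0 := by
  have h1 : HasFDerivAt (fun θ' : Vec k => ((0, θ') : Vec b × Vec k))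
      (ContinuousLinearMap.inr ℝ (Vec b) (Vec k)) θ := hasFDerivAt_prodMk_right 0 θ
  have h2 := hF.hasFDerivAt.comp θ h1
  have h3 : HasFDerivAt (F ∘ fun θ' : Vec k => ((0, θ') : Vec b × Vec k))
      (0 : Vec k →L[ℝ] ℝ) θ :=
    (hasFDerivAt_const (0 : ℝ) θ).congr_of_eventuallyEq h0
  simpa using DFunLike.congr_fun (h2.unique h3) w

/-- Moving `δ` by `t` in direction `i` turns a ratio of one into `1 + t * T i`, so the `j`-th
derivative is `T j / (1 + t * T i)`. It is stated for any `δ` with ratio one because it serves to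
prove that the true `δ` is zero. -/
theorem hessian_logRatio_inl_inl (hU : IsOpen U)
    (hT : ContDiffOn ℝ 2 (fun θ => steinFeature (p θ) f x) U) {θ : Vec k} (hθ : θ ∈ U)
    {δ : Vec b} (hδ : ratio p f θ x δ = 1) (i j : Fin b) :
    hessian (logRatio p f x) (δ, θ) (Sum.inl i) (Sum.inl j)
      = -(steinFeature (p θ) f x i * steinFeature (p θ) f x j) := by
  set T := steinFeature (p θ) f x with hTdef
  have hr : (0 : ℝ) < ratio p f θ x δ := by simp [hδ]
  have h1 := hasDerivAt_fderiv_coordVec (contDiffAt_logRatio (η := (δ, θ)) hU hT hθ hr)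
    (Sum.inl i) (Sum.inl j)
  have h2 : HasDerivAt (fun t : ℝ => T j / (t * T i + 1)) (-(T i * T j)) 0 := by
    have := (hasDerivAt_const (0 : ℝ) (T j)).fun_div
      (((hasDerivAt_id (0 : ℝ)).mul_const (T i)).add_const 1) (by simp)
    refine this.congr_deriv ?_
    simp
    ring
  refine h1.unique (h2.congr_of_eventuallyEq ?_)
  have hpos : ∀ᶠ t : ℝ in 𝓝 0, 0 < t * T i + 1 := by
    have : Continuous fun t : ℝ => t * T i + 1 := by fun_prop
    exact continuousAt_const.eventually_lt this.continuousAt (by simp)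
  filter_upwards [hpos] with t ht
  have hrt : ratio p f θ x (δ + t • EuclideanSpace.single i 1) = t * T i + 1 := by
    have hδ' : inner ℝ δ T = 0 := by simpa [ratio, hTdef] using hδ
    simp only [ratio, inner_add_left, real_inner_smul_left, EuclideanSpace.inner_single_left,
      ← hTdef, hδ']
    simp
  have := fderiv_logRatio_apply (η := (δ + t • EuclideanSpace.single i 1, θ)) hU hT hθ
    (by rwa [hrt]) (EuclideanSpace.single j 1)
  rw [hrt] at this
  simpa [coordVec, EuclideanSpace.inner_single_left] using this

/-- The log ratio is constant in `θ` when `δ = 0`, which produces the zero block of the saddle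
matrix. -/
theorem hessian_logRatio_inr_inr (hU : IsOpen U)
    (hT : ContDiffOn ℝ 2 (fun θ => steinFeature (p θ) f x) U) {θ : Vec k} (hθ : θ ∈ U)
    (i j : Fin k) : hessian (logRatio p f x) (0, θ) (Sum.inr i) (Sum.inr j) = 0 := by
  have hC : ∀ θ ∈ U, ContDiffAt ℝ 2 (logRatio p f x) (0, θ) := fun θ hθ =>
    contDiffAt_logRatio hU hT hθ (by simp [ratio_zero])
  refine (hasDerivAt_fderiv_coordVec (hC θ hθ) (Sum.inr i) (Sum.inr j)).unique
    ((hasDerivAt_const (0 : ℝ) (0 : ℝ)).congr_of_eventuallyEq ?_)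
  have hc : Tendsto (fun t : ℝ => θ + t • EuclideanSpace.single i (1 : ℝ)) (𝓝 0) (𝓝 θ) := by
    have : Continuous fun t : ℝ => θ + t • EuclideanSpace.single i (1 : ℝ) := by fun_prop
    simpa using this.tendsto 0
  filter_upwards [hc.eventually (hU.mem_nhds hθ)] with t ht
  have := fderiv_apply_snd_eq_zero ((hC _ ht).differentiableAt (by norm_num))
    (Eventually.of_forall fun θ' => logRatio_zero θ') (EuclideanSpace.single j 1)
  simpa [coordVec] using this

theorem meanHessian_inl_inl (hU : IsOpen U)
    (hT : ∀ x, ContDiffOn ℝ 2 (fun θ => steinFeature (p θ) f x) U) {θ : Vec k} (hθ : θ ∈ U)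
    {δ : Vec b} (hδ : ∀ x, ratio p f θ x δ = 1) (Q : Measure (Vec d)) (i j : Fin b) :
    meanHessian p f Q (δ, θ) (Sum.inl i) (Sum.inl j)
      = -∫ x, steinFeature (p θ) f x i * steinFeature (p θ) f x j ∂Q := by
  simp only [meanHessian, hessian_logRatio_inl_inl hU (hT _) hθ (hδ _), integral_neg]

theorem meanHessian_inr_inr (hU : IsOpen U)
    (hT : ∀ x, ContDiffOn ℝ 2 (fun θ => steinFeature (p θ) f x) U) {θ : Vec k} (hθ : θ ∈ U)
    (Q : Measure (Vec d)) (i j : Fin k) :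
    meanHessian p f Q (0, θ) (Sum.inr i) (Sum.inr j) = 0 := by
  simp only [meanHessian, hessian_logRatio_inr_inr hU (hT _) hθ, integral_zero]

theorem meanHessian_symm (hU : IsOpen U)
    (hT : ∀ x, ContDiffOn ℝ 2 (fun θ => steinFeature (p θ) f x) U) {θ : Vec k} (hθ : θ ∈ U)
    (Q : Measure (Vec d)) (i j : Fin b ⊕ Fin k) :
    meanHessian p f Q (0, θ) i j = meanHessian p f Q (0, θ) j i := by
  simp only [meanHessian]
  congr 1
  ext x
  exact hessian_symm (contDiffAt_logRatio hU (hT x) hθ (by simp [ratio_zero])) i j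

variable {n : ℕ} {y : ℕ → Vec d}

theorem objective_zero (θ : Vec k) : objective p f n y (0, θ) = 0 := by
  simp [objective, logRatio_zero]

theorem contDiffAt_objective (hU : IsOpen U)
    (hT : ∀ x, ContDiffOn ℝ 2 (fun θ => steinFeature (p θ) f x) U) {η : Vec b × Vec k}
    (hη : η.2 ∈ U) (hr : ∀ i < n, 0 < ratio p f η.2 (y i) η.1) :
    ContDiffAt ℝ 2 (objective p f n y) η :=
  contDiffAt_const.mul (ContDiffAt.sum fun i hi =>
    contDiffAt_logRatio hU (hT _) hη (hr i (Finset.mem_range.1 hi)))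

/-- The sample mean of the Stein features. -/
noncomputable def sampleStein (p : Vec k → Vec d → ℝ) (f : Vec d → Vec b) (n : ℕ) (y : ℕ → Vec d) (θ : Vec k) :
    Vec b :=
  (n : ℝ)⁻¹ • ∑ i ∈ Finset.range n, steinFeature (p θ) f (y i)

theorem fderiv_objective_zero_inl (hU : IsOpen U)
    (hT : ∀ x, ContDiffOn ℝ 2 (fun θ => steinFeature (p θ) f x) U) {θ : Vec k} (hθ : θ ∈ U)
    (j : Fin b) : fderiv ℝ (objective p f n y) (0, θ) (coordVec (Sum.inl j))
      = sampleStein p f n y θ j := by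
  have hr : ∀ x, (0 : ℝ) < ratio p f θ x 0 := fun x => by simp [ratio_zero]
  have h : HasFDerivAt (objective p f n y)
      ((n : ℝ)⁻¹ • ∑ i ∈ Finset.range n, fderiv ℝ (logRatio p f (y i)) (0, θ)) (0, θ) :=
    (HasFDerivAt.fun_sum fun i _ => ((contDiffAt_logRatio (η := (0, θ)) hU (hT _) hθ
      (hr (y i))).differentiableAt (by norm_num)).hasFDerivAt).const_mul _
  rw [h.fderiv]
  simp only [coordVec, _root_.smul_apply, _root_.sum_apply]
  simp_rw [fderiv_logRatio_apply (η := (0, θ)) hU (hT _) hθ (hr _), ratio_zero]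
  simp [sampleStein, EuclideanSpace.inner_single_left]

theorem fderiv_objective_zero_inr (hU : IsOpen U)
    (hT : ∀ x, ContDiffOn ℝ 2 (fun θ => steinFeature (p θ) f x) U) {θ : Vec k} (hθ : θ ∈ U)
    (j : Fin k) : fderiv ℝ (objective p f n y) (0, θ) (coordVec (Sum.inr j)) = 0 :=
  fderiv_apply_snd_eq_zero ((contDiffAt_objective (η := (0, θ)) hU hT hθ
    fun _ _ => by simp [ratio_zero]).differentiableAt (by norm_num))
    (Eventually.of_forall fun θ' => objective_zero θ') _

end Model

/-! ### Continuity and divergence form of the Stein feature. -/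

section Feature

variable {d b : ℕ} {p : Vec d → ℝ} {f : Vec d → Vec b}

theorem continuous_partialDeriv {g : Vec d → ℝ} (hg : ContDiff ℝ 1 g) (j : Fin d) :
    Continuous (partialDeriv j g) :=
  (hg.continuous_fderiv (by norm_num)).clm_apply continuous_const

theorem contDiff_partialDeriv {g : Vec d → ℝ} (hg : ContDiff ℝ 2 g) (j : Fin d) :
    ContDiff ℝ 1 (partialDeriv j g) :=
  (hg.fderiv_right (m := 1) (by norm_num)).clm_apply contDiff_const

theorem continuous_gradient {g : Vec d → ℝ} (hg : ContDiff ℝ 1 g) : Continuous (gradient g) :=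
  (LinearIsometryEquiv.continuous _).comp (hg.continuous_fderiv (by norm_num))

theorem SteinRegular.contDiff_apply (h : SteinRegular p f) (i : Fin b) :
    ContDiff ℝ 2 fun y => f y i :=
  contDiff_euclidean.1 h.feature_smooth i

theorem SteinRegular.continuous_steinFeature (h : SteinRegular p f) (hp : IsPosDensity p) :
    Continuous (steinFeature p f) := by
  refine (PiLp.continuous_toLp 2 _).comp (continuous_pi fun i => ?_)
  have hi := h.contDiff_apply i
  refine ((continuous_gradient (h.density_smooth.log fun x => (hp.pos x).ne')).inner
    (continuous_gradient (hi.of_le (by norm_num)))).add ?_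
  exact continuous_finsetSum _ fun j _ => continuous_partialDeriv (contDiff_partialDeriv hi j) j

theorem inner_gradient {g h : Vec d → ℝ} (x : Vec d) :
    inner ℝ (gradient g x) (gradient h x) = ∑ j, partialDeriv j g x * partialDeriv j h x := by
  have e : ∀ (g : Vec d → ℝ) (j : Fin d), gradient g x j = partialDeriv j g x := fun g j => by
    have : inner ℝ (gradient g x) (EuclideanSpace.single j 1) = partialDeriv j g x := by
      simp [gradient, partialDeriv]
    rw [← this, EuclideanSpace.inner_single_right]
    simp
  rw [PiLp.inner_apply]
  refine Finset.sum_congr rfl fun j _ => ?_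
  rw [e, e]
  simp [mul_comm]

/-- The density times the Stein feature is a divergence. -/
theorem mul_steinFeature (h : SteinRegular p f) (hp : IsPosDensity p) (i : Fin b) (x : Vec d) :
    p x * steinFeature p f x i
      = ∑ j, partialDeriv j (fun y => p y * partialDeriv j (fun z => f z i) y) x := by
  have hi := h.contDiff_apply i
  have hpd : DifferentiableAt ℝ p x := h.density_smooth.differentiable (by norm_num) x
  simp only [steinFeature, steinOp]
  rw [inner_gradient, ← Finset.sum_add_distrib, Finset.mul_sum]
  refine Finset.sum_congr rfl fun j _ => ?_
  have h1 : partialDeriv j (fun y => Real.log (p y)) x = (p x)⁻¹ * partialDeriv j p x := by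
    rw [partialDeriv, fderiv.log hpd (hp.pos x).ne']
    rfl
  have h2 : partialDeriv j (fun y => p y * partialDeriv j (fun z => f z i) y) x
      = p x * partialDeriv j (partialDeriv j fun z => f z i) x
        + partialDeriv j (fun z => f z i) x * partialDeriv j p x := by
    have hd : DifferentiableAt ℝ (partialDeriv j fun z => f z i) x :=
      (contDiff_partialDeriv hi j).differentiable (by norm_num) x
    conv_lhs => rw [partialDeriv, fderiv_fun_mul hpd hd]
    rfl
  rw [h1, h2]
  field_simp [(hp.pos x).ne']
  ring

end Feature

/-! ### Stein's identity by integration along coordinate lines. -/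

section SteinIdentity

/-- By Fubini the `j`-th coordinate can be integrated first. On almost every line parallel to that
axis the derivative is integrable, and the fundamental theorem of calculus gives the difference of
two vanishing limits. -/
theorem integral_partialDeriv_eq_zero {d : ℕ} {g : Vec d → ℝ} (hg : ContDiff ℝ 1 g) (j : Fin d)
    (hdecay : ∀ x, Tendsto (fun t : ℝ => g (x + t • EuclideanSpace.single j 1))
      (cocompact ℝ) (𝓝 0))
    (hint : Integrable (partialDeriv j g)) : ∫ x, partialDeriv j g x = 0 := by
  obtain ⟨m, rfl⟩ : ∃ m, d = m + 1 := ⟨d - 1, by have := j.pos; omega⟩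
  have hv := PiLp.volume_preserving_toLp (Fin (m + 1))
  have he := (volume_preserving_piFinSuccAbove (fun _ : Fin (m + 1) => ℝ) j).symm
  have hcomp := hv.comp he
  have hemb : MeasurableEmbedding (WithLp.toLp 2 ∘
      (MeasurableEquiv.piFinSuccAbove (fun _ : Fin (m + 1) => ℝ) j).symm) :=
    (MeasurableEquiv.toLp 2 (Fin (m + 1) → ℝ)).measurableEmbedding.comp
      (MeasurableEquiv.measurableEmbedding _)
  have hint' := (hcomp.integrable_comp_emb hemb).2 hint
  rw [← hcomp.integral_comp hemb]
  rw [Measure.volume_eq_prod] at hint' ⊢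
  have := integral_prod_symm _ hint'
  simp only [Function.comp_apply] at this ⊢
  rw [this]
  refine integral_eq_zero_of_ae ?_
  filter_upwards [hint'.prod_left_ae] with y hy
  have hline : ∀ t : ℝ, WithLp.toLp 2
      ((MeasurableEquiv.piFinSuccAbove (fun _ : Fin (m + 1) => ℝ) j).symm (t, y))
      = WithLp.toLp 2 (j.insertNth (0 : ℝ) y : Fin (m + 1) → ℝ)
        + t • EuclideanSpace.single j (1 : ℝ) := fun t => by
    ext i
    refine Fin.succAboveCases j ?_ (fun i => ?_) i <;>
      simp [MeasurableEquiv.piFinSuccAbove, Fin.insertNthEquiv]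
  simp only [Function.comp_apply, hline] at hy ⊢
  have hd := hdecay (WithLp.toLp 2 (j.insertNth (0 : ℝ) y : Fin (m + 1) → ℝ))
  rw [cocompact_eq_atBot_atTop, tendsto_sup] at hd
  rw [integral_of_hasDerivAt_of_tendsto (fun t => ?_) hy hd.1 hd.2]
  · simp
  · have h1 : HasDerivAt (fun s : ℝ => WithLp.toLp 2 (j.insertNth (0 : ℝ) y : Fin (m + 1) → ℝ)
        + s • EuclideanSpace.single j (1 : ℝ)) (EuclideanSpace.single j 1) t := by
      simpa using ((hasDerivAt_id t).smul_const
        (EuclideanSpace.single j (1 : ℝ) : Vec (m + 1))).const_add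
          (WithLp.toLp 2 (j.insertNth (0 : ℝ) y : Fin (m + 1) → ℝ))
    exact (hg.differentiable (by norm_num) _).hasFDerivAt.comp_hasDerivAt t h1

/-- **Stein's identity.** -/
theorem integral_steinFeature_eq_zero {d b : ℕ} {p : Vec d → ℝ} {f : Vec d → Vec b}
    {Q : Measure (Vec d)} (h : SteinRegular p f) (hp : IsPosDensity p)
    (hQ : Q = volume.withDensity fun x => ENNReal.ofReal (p x))
    (hint : Integrable (steinFeature p f) Q) : ∫ x, steinFeature p f x ∂Q = 0 := by
  ext i
  have hc : ∫ x, steinFeature p f x i ∂Q = (∫ x, steinFeature p f x ∂Q) i :=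
    (EuclideanSpace.proj (𝕜 := ℝ) i).integral_comp_comm hint
  rw [← hc, hQ, integral_withDensity_eq_integral_toReal_smul
    (h.density_smooth.continuous.measurable.ennreal_ofReal) (by simp)]
  simp only [ENNReal.toReal_ofReal (hp.pos _).le, smul_eq_mul, mul_steinFeature h hp]
  rw [integral_finsetSum _ fun j _ => h.integrable i j]
  refine Finset.sum_eq_zero fun j _ => ?_
  exact integral_partialDeriv_eq_zero
    (h.density_smooth.mul (contDiff_partialDeriv (h.contDiff_apply i) j)) j
    (h.decay i j) (h.integrable i j)

end SteinIdentity

/-! ### Linear algebra of the saddle point system. -/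

section SaddleSystem

variable {b k : ℕ}

open scoped MatrixOrder in
theorem exists_eq_conjTranspose_mul_self {S : Matrix (Fin b) (Fin b) ℝ} (hS : S.PosDef) :
    ∃ B : Matrix (Fin b) (Fin b) ℝ, IsUnit B.det ∧ S = Bᴴ * B := by
  obtain ⟨B, rfl⟩ := CStarAlgebra.nonneg_iff_eq_star_mul_self.mp hS.posSemidef.nonneg
  refine ⟨B, ?_, rfl⟩
  have h := (Matrix.isUnit_iff_isUnit_det _).1 hS.isUnit
  rw [Matrix.det_mul] at h
  exact (IsUnit.mul_iff.1 h).2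

/-- A basis of the kernel of `Dᵀ` which is orthonormal for the inner product given by `S`. -/
theorem exists_orthonormal_ker {S : Matrix (Fin b) (Fin b) ℝ} (hS : S.PosDef)
    {D : Matrix (Fin b) (Fin k) ℝ} (hD : D.rank = k) :
    ∃ e : Fin (b - k) → Fin b → ℝ, (∀ i, Dᵀ *ᵥ e i = 0)
      ∧ (∀ i j, e i ⬝ᵥ S *ᵥ e j = if i = j then 1 else 0)
      ∧ ∀ u, Dᵀ *ᵥ u = 0 → u ⬝ᵥ S *ᵥ u = ∑ i, (e i ⬝ᵥ S *ᵥ u) ^ 2 := by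
  obtain ⟨B, hB, rfl⟩ := exists_eq_conjTranspose_mul_self hS
  have hform : ∀ u v : Fin b → ℝ, u ⬝ᵥ (Bᴴ * B) *ᵥ v
      = inner ℝ (WithLp.toLp 2 (B *ᵥ u) : Vec b) (WithLp.toLp 2 (B *ᵥ v)) := fun u v => by
    rw [EuclideanSpace.inner_toLp_toLp, star_trivial, ← Matrix.mulVec_mulVec,
      Matrix.conjTranspose_eq_transpose_of_trivial, Matrix.dotProduct_mulVec,
      Matrix.vecMul_transpose, dotProduct_comm]
  -- Multiplication by `B` carries the `S`-form to the Euclidean inner product and the kernel of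
  -- `Dᵀ` to that of `A`, so an ordinary orthonormal basis of the latter can be pulled back by
  -- `B⁻¹`.
  let A : Matrix (Fin k) (Fin b) ℝ := Dᵀ * B⁻¹
  let L : Vec b →ₗ[ℝ] Vec k := Matrix.toEuclideanLin A
  have hL : Module.finrank ℝ (LinearMap.ker L) = b - k := by
    have h1 := LinearMap.finrank_range_add_finrank_ker L
    have h2 : Module.finrank ℝ (LinearMap.range L) = k := by
      have h3 : L = Matrix.toLin (EuclideanSpace.basisFun _ ℝ).toBasis
        (EuclideanSpace.basisFun _ ℝ).toBasis A :=
          DFunLike.congr_fun Matrix.toEuclideanLin_eq_toLin_orthonormal A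
      rw [h3, ← Matrix.rank_eq_finrank_range_toLin A (EuclideanSpace.basisFun _ ℝ).toBasis
        (EuclideanSpace.basisFun _ ℝ).toBasis, Matrix.rank_mul_eq_left_of_isUnit_det _ _
          (Matrix.isUnit_nonsing_inv_det _ hB), Matrix.rank_transpose, hD]
    rw [h2, finrank_euclideanSpace_fin] at h1
    omega
  let w : OrthonormalBasis (Fin (b - k)) ℝ (LinearMap.ker L) :=
    (stdOrthonormalBasis ℝ (LinearMap.ker L)).reindex (finCongr hL)
  have hBe : ∀ v : Fin b → ℝ, B *ᵥ (B⁻¹ *ᵥ v) = v := fun v => by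
    rw [Matrix.mulVec_mulVec, Matrix.mul_nonsing_inv _ hB, Matrix.one_mulVec]
  have hBi : ∀ v : Fin b → ℝ, B⁻¹ *ᵥ (B *ᵥ v) = v := fun v => by
    rw [Matrix.mulVec_mulVec, Matrix.nonsing_inv_mul _ hB, Matrix.one_mulVec]
  refine ⟨fun i => B⁻¹ *ᵥ (w i : Vec b).ofLp, fun i => ?_, fun i j => ?_, fun u hu => ?_⟩
  · have h : L (w i) = 0 := (w i).2
    have h' := congrArg WithLp.ofLp h
    simpa [L, A, Matrix.toLpLin_apply, Matrix.mulVec_mulVec] using h'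
  · rw [hform, hBe, hBe]
    simpa using orthonormal_iff_ite.1 w.orthonormal i j
  · have hu' : (WithLp.toLp 2 (B *ᵥ u) : Vec b) ∈ LinearMap.ker L := by
      rw [LinearMap.mem_ker]
      simp only [L, A, Matrix.toLpLin_apply]
      rw [← Matrix.mulVec_mulVec, hBi, hu]
      simp
    have h := w.sum_sq_norm_inner_right ⟨_, hu'⟩
    rw [hform, real_inner_self_eq_norm_sq]
    simp only [Submodule.coe_norm, Submodule.coe_inner, Real.norm_eq_abs, sq_abs] at h
    rw [← h]
    exact Finset.sum_congr rfl fun i _ => by rw [hform, hBe]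

variable {S : Matrix (Fin b) (Fin b) ℝ} {D : Matrix (Fin b) (Fin k) ℝ}

theorem injective_mulVec_of_rank_eq (hD : D.rank = k) : Function.Injective D.mulVec := by
  have h1 := LinearMap.finrank_range_add_finrank_ker D.mulVecLin
  have h2 : Module.finrank ℝ (LinearMap.range D.mulVecLin) = k := hD
  rw [h2, Module.finrank_fin_fun] at h1
  have h3 : LinearMap.ker D.mulVecLin = ⊥ := Submodule.finrank_eq_zero.1 (by omega)
  exact LinearMap.ker_eq_bot.1 h3

/-- The matrix of the saddle point system. -/
def saddleMatrix (S : Matrix (Fin b) (Fin b) ℝ) (D : Matrix (Fin b) (Fin k) ℝ) :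
    Matrix (Fin b ⊕ Fin k) (Fin b ⊕ Fin k) ℝ :=
  Matrix.fromBlocks (-S) D Dᵀ 0

theorem vecMul_saddleMatrix (hS : S.IsHermitian) (u : Fin b → ℝ) (v : Fin k → ℝ) :
    Sum.elim u v ᵥ* saddleMatrix S D = Sum.elim (-(S *ᵥ u) + D *ᵥ v) (Dᵀ *ᵥ u) := by
  have : Sᵀ = S := hS
  rw [saddleMatrix, Matrix.vecMul_fromBlocks]
  congr 1
  · rw [← Matrix.mulVec_transpose (-S), Matrix.vecMul_transpose, Matrix.transpose_neg, this,
      Matrix.neg_mulVec]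
    rfl
  · rw [Matrix.vecMul_zero, add_zero, ← Matrix.mulVec_transpose]
    rfl

theorem dotProduct_mulVec_eq (u : Fin b → ℝ) (v : Fin k → ℝ) :
    u ⬝ᵥ D *ᵥ v = (Dᵀ *ᵥ u) ⬝ᵥ v := by
  rw [Matrix.dotProduct_mulVec, ← Matrix.mulVec_transpose]

/-- A null vector satisfies `S *ᵥ u = D *ᵥ v` and `Dᵀ *ᵥ u = 0`. Pairing the first with `u` kills
the right side, so `u = 0` by definiteness, and then `v = 0` by full column rank. -/
theorem vecMul_saddleMatrix_injective (hS : S.PosDef) (hD : D.rank = k) :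
    LinearMap.ker (saddleMatrix S D).vecMulLinear = ⊥ := by
  rw [LinearMap.ker_eq_bot']
  intro z hz
  rw [← Sum.elim_comp_inl_inr z] at hz ⊢
  set u := z ∘ Sum.inl
  set v := z ∘ Sum.inr
  rw [Matrix.vecMulLinear_apply, vecMul_saddleMatrix hS.1] at hz
  have h1 : -(S *ᵥ u) + D *ᵥ v = 0 := funext fun i => congrFun hz (Sum.inl i)
  have h2 : Dᵀ *ᵥ u = 0 := funext fun i => congrFun hz (Sum.inr i)
  have hu : u = 0 := by
    by_contra hu
    have hp := hS.dotProduct_mulVec_pos hu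
    have h3 : S *ᵥ u = D *ᵥ v := (neg_add_eq_zero.1 h1)
    rw [h3, star_trivial, dotProduct_mulVec_eq, h2, zero_dotProduct] at hp
    exact hp.false
  rw [hu, Matrix.mulVec_zero, neg_zero, zero_add] at h1
  have hv : v = 0 := injective_mulVec_of_rank_eq hD (by simpa using h1)
  rw [hu, hv]
  ext i
  rcases i with i | i <;> rfl

/-- The first component `u` of the solution lies in the kernel of `Dᵀ`, and `s = S *ᵥ u - D *ᵥ v`.
Against kernel vectors the `D` term disappears, so the value is `s ⬝ᵥ u = u ⬝ᵥ S *ᵥ u`, which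
Parseval in the basis `e` expresses through `s` alone. -/
theorem quadratic_of_vecMul_saddleMatrix_eq (hS : S.PosDef) {m : ℕ} {e : Fin m → Fin b → ℝ}
    (he : ∀ i, Dᵀ *ᵥ e i = 0)
    (hpar : ∀ u, Dᵀ *ᵥ u = 0 → u ⬝ᵥ S *ᵥ u = ∑ i, (e i ⬝ᵥ S *ᵥ u) ^ 2)
    {z : Fin b ⊕ Fin k → ℝ} {s : Fin b → ℝ}
    (hz : z ᵥ* saddleMatrix S D = -Sum.elim s 0) :
    -((z ᵥ* saddleMatrix S D) ⬝ᵥ z) = ∑ i, (e i ⬝ᵥ s) ^ 2 := by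
  rw [← Sum.elim_comp_inl_inr z] at hz ⊢
  set u := z ∘ Sum.inl
  set v := z ∘ Sum.inr
  have hz' := hz
  rw [vecMul_saddleMatrix hS.1] at hz'
  have h1 : -(S *ᵥ u) + D *ᵥ v = -s := funext fun i => congrFun hz' (Sum.inl i)
  have h2 : Dᵀ *ᵥ u = 0 := funext fun i => by simpa using congrFun hz' (Sum.inr i)
  have h3 : s = S *ᵥ u - D *ᵥ v := by rw [← neg_neg s, ← h1]; abel
  have h4 : ∀ w, Dᵀ *ᵥ w = 0 → w ⬝ᵥ s = w ⬝ᵥ S *ᵥ u := fun w hw => by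
    rw [h3, dotProduct_sub, dotProduct_mulVec_eq (D := D), hw, zero_dotProduct, sub_zero]
  rw [hz, neg_dotProduct, neg_neg, sumElim_dotProduct_sumElim, zero_dotProduct, add_zero,
    dotProduct_comm, h4 u h2, hpar u h2]
  exact Finset.sum_congr rfl fun i _ => by rw [h4 _ (he i)]

theorem abs_dotProduct_le {ι : Type*} [Fintype ι] (x y : ι → ℝ) :
    |x ⬝ᵥ y| ≤ Fintype.card ι * (‖x‖ * ‖y‖) := by
  rw [dotProduct, ← nsmul_eq_mul]
  refine (Finset.abs_sum_le_sum_abs _ _).trans (Finset.sum_le_card_nsmul _ _ _ fun i _ => ?_)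
  rw [abs_mul]
  exact mul_le_mul (norm_le_pi_norm x i) (norm_le_pi_norm y i) (abs_nonneg _) (norm_nonneg _)

/-- Stability of the value of the saddle point problem under perturbations of the system. -/
theorem exists_abs_sub_sum_sq_le (hS : S.PosDef) (hD : D.rank = k) {m : ℕ}
    {e : Fin m → Fin b → ℝ} (he : ∀ i, Dᵀ *ᵥ e i = 0)
    (hpar : ∀ u, Dᵀ *ᵥ u = 0 → u ⬝ᵥ S *ᵥ u = ∑ i, (e i ⬝ᵥ S *ᵥ u) ^ 2) :
    ∃ C : ℝ, 0 < C ∧ ∃ ε₀ : ℝ, 0 < ε₀ ∧ ∀ ε, 0 ≤ ε → ε ≤ ε₀ →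
      ∀ (z : Fin b ⊕ Fin k → ℝ) (s : Fin b → ℝ) (l : ℝ),
      ‖z ᵥ* saddleMatrix S D + Sum.elim s 0‖ ≤ ε * ‖z‖ →
      |l + 2⁻¹ * ((z ᵥ* saddleMatrix S D) ⬝ᵥ z)| ≤ ε * ‖z‖ ^ 2 →
      |2 * l - ∑ i, (e i ⬝ᵥ s) ^ 2| ≤ C * ε * ‖s‖ ^ 2 := by
  set M := saddleMatrix S D
  have hker := vecMul_saddleMatrix_injective hS hD
  obtain ⟨K, hK, hanti⟩ := LinearMap.exists_antilipschitzWith M.vecMulLinear hker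
  have hlow : ∀ z, ‖z‖ ≤ K * ‖z ᵥ* M‖ := fun z => by
    simpa using hanti.le_mul_dist z 0
  have hsurj : Function.Surjective M.vecMulLinear :=
    LinearMap.injective_iff_surjective.1 (LinearMap.ker_eq_bot.1 hker)
  let Mc := LinearMap.toContinuousLinearMap M.vecMulLinear
  have hup : ∀ z, ‖z ᵥ* M‖ ≤ ‖Mc‖ * ‖z‖ := fun z => Mc.le_opNorm z
  set N : ℝ := (Fintype.card (Fin b ⊕ Fin k) : ℝ)
  have hq : ∀ x y, |(x ᵥ* M) ⬝ᵥ y| ≤ N * ‖Mc‖ * (‖x‖ * ‖y‖) := fun x y => by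
    refine (abs_dotProduct_le _ _).trans ?_
    rw [mul_assoc N, ← mul_assoc ‖Mc‖]
    exact mul_le_mul_of_nonneg_left (mul_le_mul_of_nonneg_right (hup x) (norm_nonneg _))
      (Nat.cast_nonneg _)
  have hN : 0 ≤ N := Nat.cast_nonneg _
  have hK' : (0 : ℝ) < K := by exact_mod_cast hK
  -- The threshold `(2 * K)⁻¹` lets `K * ε * ‖z‖` be absorbed, giving `‖z‖ ≤ 2 * K * ‖s‖`. Then `8 =
  -- 2 * 2 ^ 2` comes from the error in `2 * l`, and `6 = 4 + 2` from the two terms of `hsplit`.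
  refine ⟨8 * K ^ 2 + N * ‖Mc‖ * (6 * K ^ 3), by positivity, (2 * K)⁻¹, by positivity,
    fun ε hε hε₀ z s l h1 h2 => ?_⟩
  -- The exact solution, with which the approximate solution `z` is compared.
  obtain ⟨z₀, hz₀⟩ := hsurj (-Sum.elim s 0)
  rw [Matrix.vecMulLinear_apply] at hz₀
  have hs : ‖(Sum.elim s 0 : Fin b ⊕ Fin k → ℝ)‖ ≤ ‖s‖ := by
    refine (pi_norm_le_iff_of_nonneg (norm_nonneg _)).2 fun i => ?_
    rcases i with i | i
    · exact norm_le_pi_norm s i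
    · simp
  have hz₀n : ‖z₀‖ ≤ K * ‖s‖ := by
    refine (hlow z₀).trans (mul_le_mul_of_nonneg_left ?_ hK'.le)
    rw [hz₀, norm_neg]
    exact hs
  have hKε : K * ε ≤ 1 / 2 := by
    calc (K : ℝ) * ε ≤ (K : ℝ) * (2 * (K : ℝ))⁻¹ := mul_le_mul_of_nonneg_left hε₀ hK'.le
      _ = (1 / 2 : ℝ) := by field_simp
  have hzz : ‖z - z₀‖ ≤ K * ε * ‖z‖ := by
    refine (hlow _).trans ?_
    rw [mul_assoc]
    refine mul_le_mul_of_nonneg_left ?_ hK'.le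
    rwa [Matrix.sub_vecMul, hz₀, sub_neg_eq_add]
  have hzn : ‖z‖ ≤ 2 * K * ‖s‖ := by
    have h3 : ‖z‖ ≤ ‖z - z₀‖ + ‖z₀‖ := by simpa using norm_add_le (z - z₀) z₀
    have h4 : K * ε * ‖z‖ ≤ 1 / 2 * ‖z‖ := mul_le_mul_of_nonneg_right hKε (norm_nonneg _)
    nlinarith
  have hd : ‖z - z₀‖ ≤ K * ε * (2 * K * ‖s‖) :=
    hzz.trans (mul_le_mul_of_nonneg_left hzn (by positivity))
  have hsplit : (z ᵥ* M) ⬝ᵥ z - (z₀ ᵥ* M) ⬝ᵥ z₀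
      = ((z - z₀) ᵥ* M) ⬝ᵥ z + (z₀ ᵥ* M) ⬝ᵥ (z - z₀) := by
    rw [Matrix.sub_vecMul, sub_dotProduct, dotProduct_sub]
    ring
  have hqd : |(z ᵥ* M) ⬝ᵥ z - (z₀ ᵥ* M) ⬝ᵥ z₀|
      ≤ N * ‖Mc‖ * (6 * K ^ 3) * ε * ‖s‖ ^ 2 := by
    rw [hsplit]
    refine (abs_add_le _ _).trans ((add_le_add (hq _ _) (hq _ _)).trans ?_)
    have a1 : ‖z - z₀‖ * ‖z‖ ≤ K * ε * (2 * K * ‖s‖) * (2 * K * ‖s‖) :=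
      mul_le_mul hd hzn (norm_nonneg _) (by positivity)
    have a2 : ‖z₀‖ * ‖z - z₀‖ ≤ K * ‖s‖ * (K * ε * (2 * K * ‖s‖)) :=
      mul_le_mul hz₀n hd (norm_nonneg _) (by positivity)
    rw [← mul_add]
    calc _ ≤ N * ‖Mc‖ * (K * ε * (2 * K * ‖s‖) * (2 * K * ‖s‖)
          + K * ‖s‖ * (K * ε * (2 * K * ‖s‖))) :=
          mul_le_mul_of_nonneg_left (add_le_add a1 a2) (by positivity)
      _ = _ := by ring
  have hl : |2 * l + (z ᵥ* M) ⬝ᵥ z| ≤ 8 * K ^ 2 * ε * ‖s‖ ^ 2 := by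
    have : 2 * l + (z ᵥ* M) ⬝ᵥ z = 2 * (l + 2⁻¹ * ((z ᵥ* M) ⬝ᵥ z)) := by ring
    rw [this, abs_mul, abs_two]
    have h3 : ‖z‖ ^ 2 ≤ (2 * K * ‖s‖) ^ 2 := pow_le_pow_left₀ (norm_nonneg _) hzn 2
    nlinarith [mul_le_mul_of_nonneg_left h3 hε]
  rw [← quadratic_of_vecMul_saddleMatrix_eq hS he hpar hz₀]
  calc |2 * l - -((z₀ ᵥ* M) ⬝ᵥ z₀)|
      = |(2 * l + (z ᵥ* M) ⬝ᵥ z) - ((z ᵥ* M) ⬝ᵥ z - (z₀ ᵥ* M) ⬝ᵥ z₀)| := by congr 1; ring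
    _ ≤ _ := (abs_sub _ _).trans (add_le_add hl hqd)
    _ = _ := by ring

end SaddleSystem

/-! ### Calculus of events of probability tending to one. -/

section HighProbability

variable {Ω : Type*} [MeasurableSpace Ω] {μ : Measure Ω} {A B : ℕ → Ω → Prop}

theorem HighProb.mono (hA : HighProb μ A) (h : ∀ᶠ n in atTop, ∀ ω, A n ω → B n ω) :
    HighProb μ B := by
  refine tendsto_of_tendsto_of_tendsto_of_le_of_le' tendsto_const_nhds hA
    (Eventually.of_forall fun _ => zero_le) ?_
  filter_upwards [h] with n hn
  exact measure_mono fun ω hω hAω => hω (hn ω hAω)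

theorem HighProb.mp (hA : HighProb μ A) (h : ∀ n ω, A n ω → B n ω) : HighProb μ B :=
  hA.mono (Eventually.of_forall h)

theorem HighProb.and (hA : HighProb μ A) (hB : HighProb μ B) :
    HighProb μ fun n ω => A n ω ∧ B n ω := by
  have h := Tendsto.add hA hB
  rw [add_zero] at h
  refine tendsto_of_tendsto_of_tendsto_of_le_of_le tendsto_const_nhds h (fun _ => zero_le)
    fun n => (measure_mono fun ω hω => ?_).trans (measure_union_le _ _)
  by_contra hc
  simp only [Set.mem_union, Set.mem_ofPred_eq, not_or, not_not] at hc
  exact hω hc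

theorem HighProb.forall {ι : Type*} [Finite ι] {A : ι → ℕ → Ω → Prop}
    (h : ∀ i, HighProb μ (A i)) : HighProb μ fun n ω => ∀ i, A i n ω := by
  have := Fintype.ofFinite ι
  have hs := tendsto_finsetSum Finset.univ fun i _ => h i
  rw [Finset.sum_const_zero] at hs
  refine tendsto_of_tendsto_of_tendsto_of_le_of_le tendsto_const_nhds hs (fun _ => zero_le)
    fun n => (measure_mono fun ω hω => ?_).trans (measure_iUnion_fintype_le _ _)
  simpa using hω

theorem highProb_of_tendstoInMeasure {E : Type*} [SeminormedAddCommGroup E] {f : ℕ → Ω → E}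
    {g : Ω → E} (h : TendstoInMeasure μ f atTop g) {ε : ℝ} (hε : 0 < ε) :
    HighProb μ fun n ω => ‖f n ω - g ω‖ < ε := by
  simpa [HighProb, not_lt] using tendstoInMeasure_iff_norm.1 h ε hε

theorem tendstoInMeasure_of_highProb {E : Type*} [SeminormedAddCommGroup E] {f : ℕ → Ω → E}
    {g : Ω → E} (h : ∀ ε, 0 < ε → HighProb μ fun n ω => ‖f n ω - g ω‖ < ε) :
    TendstoInMeasure μ f atTop g :=
  tendstoInMeasure_iff_norm.2 fun ε hε => by simpa [HighProb, not_lt] using h ε hε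

/-- A remainder that is eventually bounded by arbitrarily small multiples of a sequence which is
bounded in probability tends to zero in probability. -/
theorem highProb_abs_lt_of_tight {R V : ℕ → Ω → ℝ} {C ε₀ c : ℝ} (hC : 0 < C) (hε₀ : 0 < ε₀)
    (hR : ∀ ε, 0 < ε → ε ≤ ε₀ → HighProb μ fun n ω => |R n ω| ≤ C * ε * V n ω)
    (hV : ∀ K, 0 < K → ∀ n, μ {ω | K < V n ω} ≤ ENNReal.ofReal (c / K)) {δ : ℝ} (hδ : 0 < δ) :
    HighProb μ fun n ω => |R n ω| < δ := by
  refine ENNReal.tendsto_nhds_zero.2 fun η hη => ?_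
  obtain ⟨K, hK, hKη⟩ : ∃ K : ℝ, 0 < K ∧ ENNReal.ofReal (c / K) ≤ η / 2 := by
    have h1 : Tendsto (fun K : ℝ => ENNReal.ofReal (c / K)) atTop (𝓝 0) := by
      have := ENNReal.tendsto_ofReal (tendsto_const_nhds (x := c) |>.div_atTop tendsto_id)
      simpa using this
    have h2 := (ENNReal.tendsto_nhds_zero.1 h1 (η / 2) (ENNReal.half_pos hη.ne')).and
      (eventually_gt_atTop 0)
    obtain ⟨K, hK⟩ := h2.exists
    exact ⟨K, hK.2, hK.1⟩
  -- On the event that `V` is at most `K`, this choice bounds the remainder by `δ / 2`.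
  set ε := min ε₀ (δ / (2 * C * K)) with hε
  have hε0 : 0 < ε := lt_min hε₀ (by positivity)
  filter_upwards [ENNReal.tendsto_nhds_zero.1 (hR ε hε0 (min_le_left _ _)) (η / 2)
    (ENNReal.half_pos hη.ne')] with n hn
  calc μ {ω | ¬ |R n ω| < δ}
      ≤ μ ({ω | ¬ |R n ω| ≤ C * ε * V n ω} ∪ {ω | K < V n ω}) := measure_mono fun ω hω => by
        by_contra hc
        simp only [Set.mem_union, Set.mem_ofPred_eq, not_or, not_not, not_lt] at hc hω
        have h1 : C * ε * V n ω ≤ C * ε * K := mul_le_mul_of_nonneg_left hc.2 (by positivity)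
        have h2 : C * ε * K ≤ C * (δ / (2 * C * K)) * K := by
          gcongr
          exact min_le_right _ _
        have h3 : C * (δ / (2 * C * K)) * K = δ / 2 := by field_simp
        linarith [hc.1]
    _ ≤ η / 2 + η / 2 := (measure_union_le _ _).trans (add_le_add hn ((hV K hK n).trans hKη))
    _ = η := ENNReal.add_halves η

end HighProbability

/-! ### Limit theorems for independent samples with a common law. -/

section IndependentSample

variable {Ω 𝓧 : Type*} [MeasurableSpace Ω] [MeasurableSpace 𝓧] {μ : Measure Ω} {Q : Measure 𝓧}
  {X : ℕ → Ω → 𝓧}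

theorem identDistrib_comp {E : Type*} [MeasurableSpace E] (hlaw : ∀ i, HasLaw (X i) Q μ)
    {g : 𝓧 → E} (hg : Measurable g) (i : ℕ) :
    IdentDistrib (fun ω => g (X i ω)) (fun ω => g (X 0 ω)) μ μ :=
  IdentDistrib.comp ⟨(hlaw i).aemeasurable, (hlaw 0).aemeasurable,
    by rw [(hlaw i).map_eq, (hlaw 0).map_eq]⟩ hg

theorem memLp_comp {E : Type*} [NormedAddCommGroup E] (hlaw : ∀ i, HasLaw (X i) Q μ)
    {g : 𝓧 → E} {r : ℝ≥0∞} (hg : MemLp g r Q) (i : ℕ) : MemLp (fun ω => g (X i ω)) r μ := by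
  rw [← (hlaw i).map_eq] at hg
  exact hg.comp_of_map (hlaw i).aemeasurable

theorem integral_comp_law {E : Type*} [NormedAddCommGroup E] [NormedSpace ℝ E]
    (hlaw : ∀ i, HasLaw (X i) Q μ) {g : 𝓧 → E} (hg : AEStronglyMeasurable g Q) (i : ℕ) :
    ∫ ω, g (X i ω) ∂μ = ∫ x, g x ∂Q :=
  (hlaw i).integral_comp hg

theorem integral_sum_mul_eq_zero {m : ℕ} {g : Fin m → 𝓧 → ℝ} (hg : ∀ j, Integrable (g j) Q)
    (h0 : ∀ j, ∫ x, g j x ∂Q = 0) (t : Vec m) : ∫ x, ∑ j, t j * g j x ∂Q = 0 := by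
  rw [integral_finsetSum _ fun j _ => (hg j).const_mul _]
  simp [integral_const_mul, h0]

theorem integral_sum_mul_sq_eq {m : ℕ} {g : Fin m → 𝓧 → ℝ} (hL2 : ∀ j, MemLp (g j) 2 Q)
    (h1 : ∀ i j, ∫ x, g i x * g j x ∂Q = if i = j then 1 else 0) (t : Vec m) :
    ∫ x, (∑ j, t j * g j x) ^ 2 ∂Q = ‖t‖ ^ 2 := by
  have hi : ∀ i j, Integrable (fun x => t i * t j * (g i x * g j x)) Q := fun i j =>
    ((hL2 i).integrable_mul (hL2 j)).const_mul _
  have he : ∀ x, (∑ j, t j * g j x) ^ 2 = ∑ i, ∑ j, t i * t j * (g i x * g j x) := fun x => by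
    rw [pow_two, Finset.sum_mul_sum]
    exact Finset.sum_congr rfl fun i _ => Finset.sum_congr rfl fun j _ => by ring
  simp only [he]
  rw [integral_finsetSum _ fun i _ => integrable_finsetSum _ fun j _ => hi i j,
    EuclideanSpace.real_norm_sq_eq]
  refine Finset.sum_congr rfl fun i _ => ?_
  rw [integral_finsetSum _ fun j _ => hi i j]
  simp [integral_const_mul, h1, pow_two]

/-- The Cramér–Wold device: the direction `t` is absorbed into a scalar statistic, so the scalar
limit is needed at frequency `1` only. -/
theorem charFun_map_toLp {m : ℕ} {W : Ω → Fin m → ℝ} (hW : AEMeasurable W μ) (t : Vec m) :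
    charFun (μ.map fun ω => (WithLp.toLp 2 (W ω) : Vec m)) t
      = charFun (μ.map fun ω => ∑ j, t j * W ω j) 1 := by
  have h1 : AEMeasurable (fun ω => (WithLp.toLp 2 (W ω) : Vec m)) μ :=
    (WithLp.measurable_toLp 2 _).comp_aemeasurable hW
  have h2 : AEMeasurable (fun ω => ∑ j, t j * W ω j) μ :=
    Finset.aemeasurable_fun_sum _ fun j _ =>
      ((measurable_pi_apply j).comp_aemeasurable hW).const_mul _
  rw [charFun_apply, charFun_apply, integral_map h1 (by fun_prop), integral_map h2 (by fun_prop)]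
  simp [PiLp.inner_apply]

variable [IsProbabilityMeasure μ]

/-- The weak law of large numbers for a function of an independent sample. -/
theorem highProb_norm_sampleMean_sub_lt {E : Type*} [NormedAddCommGroup E] [NormedSpace ℝ E]
    [CompleteSpace E] [MeasurableSpace E] [BorelSpace E] [SecondCountableTopology E]
    (hlaw : ∀ i, HasLaw (X i) Q μ) (hindep : iIndepFun X μ) {g : 𝓧 → E} (hg : Measurable g)
    (hint : Integrable g Q) {ε : ℝ} (hε : 0 < ε) :
    HighProb μ fun n ω =>
      ‖(n : ℝ)⁻¹ • ∑ i ∈ Finset.range n, g (X i ω) - ∫ x, g x ∂Q‖ < ε := by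
  have hm : ∀ i, AEMeasurable (fun ω => g (X i ω)) μ := fun i =>
    hg.comp_aemeasurable (hlaw i).aemeasurable
  have h := strong_law_ae (fun i ω => g (X i ω))
    (memLp_one_iff_integrable.1 (memLp_comp hlaw (memLp_one_iff_integrable.2 hint) 0))
    (fun i j hij => (hindep.indepFun hij).comp hg hg) (identDistrib_comp hlaw hg)
  rw [integral_comp_law hlaw hint.1] at h
  refine highProb_of_tendstoInMeasure (tendstoInMeasure_of_tendsto_ae (fun n => ?_) h) hε
  exact ((Finset.aemeasurable_fun_sum _ fun i _ => hm i).const_smul ((n : ℝ)⁻¹)).aestronglyMeasurable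

/-- Chebyshev's inequality for the rescaled sample mean. -/
theorem measure_lt_mul_sq_sampleMean_le (hlaw : ∀ i, HasLaw (X i) Q μ) (hindep : iIndepFun X μ)
    {g : 𝓧 → ℝ} (hg : Measurable g) (hL2 : MemLp g 2 Q) (h0 : ∫ x, g x ∂Q = 0) {K : ℝ}
    (hK : 0 < K) (n : ℕ) :
    μ {ω | K < n * ((n : ℝ)⁻¹ * ∑ i ∈ Finset.range n, g (X i ω)) ^ 2}
      ≤ ENNReal.ofReal (Var[fun ω => g (X 0 ω); μ] / K) := by
  rcases n.eq_zero_or_pos with rfl | hn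
  · simp [hK.le.not_gt]
  have hn' : (0 : ℝ) < n := Nat.cast_pos.2 hn
  have hL : ∀ i, MemLp (fun ω => g (X i ω)) 2 μ := memLp_comp hlaw hL2
  have hvar : Var[∑ i ∈ Finset.range n, fun ω => g (X i ω); μ]
      = n * Var[fun ω => g (X 0 ω); μ] := by
    rw [IndepFun.variance_sum (fun i _ => hL i)
      fun i _ j _ hij => (hindep.indepFun hij).comp hg hg]
    simp [(identDistrib_comp hlaw hg _).variance_eq]
  have hmean : ∫ ω, (∑ i ∈ Finset.range n, fun ω => g (X i ω)) ω ∂μ = 0 := by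
    simp only [Finset.sum_apply]
    rw [integral_finsetSum _ fun i _ => (hL i).integrable (by norm_num)]
    simp [integral_comp_law hlaw hL2.1, h0]
  have hch := meas_ge_le_variance_div_sq
    -- The level `√(n * K)` makes the factor `n` in the variance of the sum cancel.
    (memLp_finsetSum' (Finset.range n) fun i _ => hL i)
    (show 0 < √(n * K) by positivity)
  rw [hvar, Real.sq_sqrt (by positivity), mul_div_mul_left _ _ hn'.ne'] at hch
  refine (measure_mono fun ω hω => ?_).trans hch
  simp only [Set.mem_ofPred_eq] at hω ⊢
  rw [hmean, sub_zero, Finset.sum_apply]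
  refine Real.sqrt_le_iff.2 ⟨abs_nonneg _, ?_⟩
  rw [sq_abs]
  have : (n : ℝ) * ((n : ℝ)⁻¹ * ∑ i ∈ Finset.range n, g (X i ω)) ^ 2
      = (∑ i ∈ Finset.range n, g (X i ω)) ^ 2 / n := by field_simp
  rw [this, lt_div_iff₀ hn'] at hω
  linarith

theorem measure_lt_mul_norm_sq_sampleMean_le (hlaw : ∀ i, HasLaw (X i) Q μ)
    (hindep : iIndepFun X μ) {ι : Type*} [Fintype ι] {g : ι → 𝓧 → ℝ} (hg : ∀ j, Measurable (g j))
    (hL2 : ∀ j, MemLp (g j) 2 Q) (h0 : ∀ j, ∫ x, g j x ∂Q = 0) {K : ℝ} (hK : 0 < K) (n : ℕ) :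
    μ {ω | K < n * ‖fun j => (n : ℝ)⁻¹ * ∑ i ∈ Finset.range n, g j (X i ω)‖ ^ 2}
      ≤ ENNReal.ofReal ((∑ j, Var[fun ω => g j (X 0 ω); μ]) / K) := by
  rw [Finset.sum_div, ENNReal.ofReal_sum_of_nonneg fun j _ =>
    div_nonneg (variance_nonneg _ _) hK.le]
  refine (measure_mono fun ω hω => ?_).trans ((measure_iUnion_fintype_le _ _).trans
    (Finset.sum_le_sum fun j _ =>
      measure_lt_mul_sq_sampleMean_le hlaw hindep (hg j) (hL2 j) (h0 j) hK n))
  by_contra hc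
  simp only [Set.mem_iUnion, Set.mem_ofPred_eq, not_exists, not_lt] at hc hω
  have hb : ‖fun j => (n : ℝ)⁻¹ * ∑ i ∈ Finset.range n, g j (X i ω)‖ ≤ √(K / n) :=
    (pi_norm_le_iff_of_nonneg (Real.sqrt_nonneg _)).2 fun j => by
      rcases n.eq_zero_or_pos with rfl | hn
      · simp
      · have hn' : (0 : ℝ) < n := Nat.cast_pos.2 hn
        refine Real.abs_le_sqrt ?_
        rw [le_div_iff₀ hn', mul_comm]
        exact hc j
  have h2 := pow_le_pow_left₀ (norm_nonneg _) hb 2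
  rw [Real.sq_sqrt (by positivity)] at h2
  have h3 := mul_le_mul_of_nonneg_left h2 (Nat.cast_nonneg (α := ℝ) n)
  rcases n.eq_zero_or_pos with rfl | hn
  · simp at hω
    linarith
  · have hn' : (n : ℝ) ≠ 0 := (Nat.cast_pos.2 hn).ne'
    rw [mul_div_cancel₀ _ hn'] at h3
    linarith

theorem map_stdGaussian_eq_chiSquared (m : ℕ) :
    (stdGaussian (Vec m)).map (fun z => ∑ i, z i ^ 2) = chiSquared m := by
  rw [← map_pi_eq_stdGaussian, Measure.map_map (by fun_prop) (by fun_prop)]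
  rfl

theorem tendsto_charFun_inv_sqrt_mul_sum (hlaw : ∀ i, HasLaw (X i) Q μ) (hindep : iIndepFun X μ)
    {g : 𝓧 → ℝ} (hg : Measurable g) (hL2 : MemLp g 2 Q) (h0 : ∫ x, g x ∂Q = 0) :
    Tendsto (fun n : ℕ => charFun (μ.map fun ω => (√n)⁻¹ * ∑ i ∈ Finset.range n, g (X i ω)) 1)
      atTop (𝓝 (Complex.exp (-(∫ x, g x ^ 2 ∂Q : ℝ) / 2))) := by
  have hg0 : ∫ ω, g (X 0 ω) ∂μ = 0 := by rw [integral_comp_law hlaw hL2.1, h0]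
  have hv : Var[fun ω => g (X 0 ω); μ] = ∫ x, g x ^ 2 ∂Q := by
    rw [variance_of_integral_eq_zero (memLp_comp hlaw hL2 0).1.aemeasurable hg0,
      integral_comp_law (g := fun x => g x ^ 2) hlaw (hg.pow_const 2).aestronglyMeasurable]
  have hclt := tendstoInDistribution_inv_sqrt_mul_sum_sub (X := fun i ω => g (X i ω))
    (P' := gaussianReal 0 Var[fun ω => g (X 0 ω); μ].toNNReal) (Y := id) HasLaw.id
    (memLp_comp hlaw hL2 0) (hindep.comp (fun _ => g) fun _ => hg) (identDistrib_comp hlaw hg)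
  have hlim := ProbabilityMeasure.tendsto_iff_tendsto_charFun.1 hclt.tendsto 1
  have hl : charFun (Measure.map id (gaussianReal 0 Var[fun ω => g (X 0 ω); μ].toNNReal)) 1
      = Complex.exp (-(∫ x, g x ^ 2 ∂Q : ℝ) / 2) := by
    rw [Measure.map_id, charFun_gaussianReal, hv,
      Real.coe_toNNReal _ (integral_nonneg fun x => sq_nonneg _)]
    simp [neg_div]
  simp only [ProbabilityMeasure.coe_mk, hl, hg0, mul_zero, sub_zero] at hlim
  exact hlim

/-- The central limit theorem for an independent sample with identity covariance. -/
theorem tendstoInDistribution_stdGaussian (hlaw : ∀ i, HasLaw (X i) Q μ) (hindep : iIndepFun X μ)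
    {m : ℕ} {g : Fin m → 𝓧 → ℝ} (hg : ∀ j, Measurable (g j)) (hL2 : ∀ j, MemLp (g j) 2 Q)
    (h0 : ∀ j, ∫ x, g j x ∂Q = 0)
    (h1 : ∀ i j, ∫ x, g i x * g j x ∂Q = if i = j then 1 else 0) :
    TendstoInDistribution (fun (n : ℕ) ω => (WithLp.toLp 2 fun j =>
        (√n)⁻¹ * ∑ i ∈ Finset.range n, g j (X i ω) : Vec m)) atTop (id : Vec m → Vec m)
      (fun _ => μ) (stdGaussian (Vec m)) := by
  have hW : ∀ n : ℕ, AEMeasurable (fun ω => fun j =>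
      (√n)⁻¹ * ∑ i ∈ Finset.range n, g j (X i ω)) μ := fun n =>
    aemeasurable_pi_lambda _ fun j => (Finset.aemeasurable_fun_sum _ fun i _ =>
      (hg j).comp_aemeasurable (hlaw i).aemeasurable).const_mul _
  have hQ : IsProbabilityMeasure Q := (hlaw 0).isProbabilityMeasure_iff.1 inferInstance
  refine ⟨fun n => (WithLp.measurable_toLp 2 _).comp_aemeasurable (hW n), aemeasurable_id,
    ProbabilityMeasure.tendsto_iff_tendsto_charFun.2 fun t => ?_⟩
  have h := tendsto_charFun_inv_sqrt_mul_sum (g := fun x => ∑ j, t j * g j x) hlaw hindep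
    (Finset.measurable_fun_sum _ fun j _ => (hg j).const_mul _)
    (memLp_finsetSum _ fun j _ => (hL2 j).const_mul _)
    (integral_sum_mul_eq_zero (fun j => (hL2 j).integrable (by norm_num)) h0 t)
  rw [integral_sum_mul_sq_eq hL2 h1, Complex.ofReal_pow, ← charFun_stdGaussian] at h
  simp only [ProbabilityMeasure.coe_mk, Measure.map_id]
  refine h.congr fun n => ?_
  rw [charFun_map_toLp (hW n)]
  congr 2
  ext ω
  simp only [Finset.mul_sum]
  rw [Finset.sum_comm]
  exact Finset.sum_congr rfl fun j _ => Finset.sum_congr rfl fun i _ => by ring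

/-- Sums of squares of asymptotically standard normal statistics are asymptotically
chi-squared. -/
theorem tendstoInDistribution_chiSquared (hlaw : ∀ i, HasLaw (X i) Q μ) (hindep : iIndepFun X μ)
    {m : ℕ} {g : Fin m → 𝓧 → ℝ} (hg : ∀ j, Measurable (g j)) (hL2 : ∀ j, MemLp (g j) 2 Q)
    (h0 : ∀ j, ∫ x, g j x ∂Q = 0)
    (h1 : ∀ i j, ∫ x, g i x * g j x ∂Q = if i = j then 1 else 0) :
    TendstoInDistribution (fun (n : ℕ) ω =>
        ∑ j, ((√n)⁻¹ * ∑ i ∈ Finset.range n, g j (X i ω)) ^ 2) atTop (id : ℝ → ℝ)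
      (fun _ => μ) (chiSquared m) := by
  have h := (tendstoInDistribution_stdGaussian hlaw hindep hg hL2 h0 h1).continuous_comp
    (g := fun z : Vec m => ∑ j, z j ^ 2) (by fun_prop)
  refine ⟨h.forall_aemeasurable, aemeasurable_id, ?_⟩
  convert! h.tendsto using 2
  ext1
  simp only [Measure.map_id, ← map_stdGaussian_eq_chiSquared]
  rfl

end IndependentSample

/-! ### Second moments of the Stein feature and the mean Hessian at the true parameter. -/

section Moments

variable {d b k : ℕ} {p : Vec k → Vec d → ℝ} {f : Vec d → Vec b} {U : Set (Vec k)}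
  {Q : Measure (Vec d)}

/-- The matrix of second moments of a random vector. -/
noncomputable def secondMoment (T : Vec d → Vec b) (Q : Measure (Vec d)) :
    Matrix (Fin b) (Fin b) ℝ :=
  fun i j => ∫ x, T x i * T x j ∂Q

theorem integral_dotProduct_mul_dotProduct {T : Vec d → Vec b}
    (hT : ∀ i j, Integrable (fun x => T x i * T x j) Q) (u v : Fin b → ℝ) :
    ∫ x, (u ⬝ᵥ (T x).ofLp) * (v ⬝ᵥ (T x).ofLp) ∂Q = u ⬝ᵥ secondMoment T Q *ᵥ v := by
  have hi : ∀ i j, Integrable (fun x => u i * v j * (T x i * T x j)) Q := fun i j =>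
    (hT i j).const_mul _
  have he : ∀ x, (u ⬝ᵥ (T x).ofLp) * (v ⬝ᵥ (T x).ofLp)
      = ∑ i, ∑ j, u i * v j * (T x i * T x j) := fun x => by
    rw [dotProduct, dotProduct, Finset.sum_mul_sum]
    exact Finset.sum_congr rfl fun i _ => Finset.sum_congr rfl fun j _ => by ring
  simp only [he]
  rw [integral_finsetSum _ fun i _ => integrable_finsetSum _ fun j _ => hi i j, dotProduct]
  refine Finset.sum_congr rfl fun i _ => ?_
  rw [integral_finsetSum _ fun j _ => hi i j, Matrix.mulVec, dotProduct, Finset.mul_sum]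
  refine Finset.sum_congr rfl fun j _ => ?_
  rw [integral_const_mul, secondMoment]
  ring

theorem posDef_secondMoment {T : Vec d → Vec b}
    (hT : ∀ i j, Integrable (fun x => T x i * T x j) Q) (hunit : IsUnit (secondMoment T Q)) :
    (secondMoment T Q).PosDef := by
  refine Matrix.PosSemidef.posDef_iff_isUnit ?_ |>.2 hunit
  refine Matrix.PosSemidef.of_dotProduct_mulVec_nonneg ?_ fun u => ?_
  · ext i j
    simp only [Matrix.conjTranspose_apply, star_trivial, secondMoment]
    exact integral_congr_ae (Eventually.of_forall fun x => mul_comm _ _)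
  · rw [star_trivial, ← integral_dotProduct_mul_dotProduct hT]
    exact integral_nonneg fun x => mul_self_nonneg _

/-- Up to sign these products are entries of the Hessian of the log ratio, so existence of the mean
Hessian already contains the second moments required by the central limit theorem. -/
theorem integrable_mul_steinFeature (hU : IsOpen U)
    (hT : ∀ x, ContDiffOn ℝ 2 (fun θ => steinFeature (p θ) f x) U) {θ : Vec k} (hθ : θ ∈ U)
    {δ : Vec b} (hδ : ∀ x, ratio p f θ x δ = 1)
    (hint : ∀ i j, Integrable (fun x => hessian (logRatio p f x) (δ, θ) i j) Q) (i j : Fin b) :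
    Integrable (fun x => steinFeature (p θ) f x i * steinFeature (p θ) f x j) Q := by
  have h := (hint (Sum.inl i) (Sum.inl j)).neg
  refine h.congr (Eventually.of_forall fun x => ?_)
  simp [hessian_logRatio_inl_inl hU (hT x) hθ (hδ x)]

theorem memLp_apply {T : Vec d → Vec b} (hc : Continuous T)
    (hT : ∀ i j, Integrable (fun x => T x i * T x j) Q) (i : Fin b) :
    MemLp (fun x => T x i) 2 Q := by
  have hm : Measurable fun x => T x i := by
    have : Continuous fun x => T x i := by fun_prop
    exact this.measurable
  exact (memLp_two_iff_integrable_sq hm.aestronglyMeasurable).2 (by simpa [pow_two] using hT i i)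

theorem integrable_of_apply {T : Vec d → Vec b} (hT : ∀ i, Integrable (fun x => T x i) Q) :
    Integrable T Q := by
  have h := integrable_finsetSum Finset.univ fun i _ =>
    (hT i).smul_const (EuclideanSpace.single i (1 : ℝ) : Vec b)
  refine h.congr (Eventually.of_forall fun x => ?_)
  ext i
  simp [Pi.single_apply]

theorem meanHessian_toBlocks₁₁ (hU : IsOpen U)
    (hT : ∀ x, ContDiffOn ℝ 2 (fun θ => steinFeature (p θ) f x) U) {θ : Vec k} (hθ : θ ∈ U)
    {δ : Vec b} (hδ : ∀ x, ratio p f θ x δ = 1) :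
    (meanHessian p f Q (δ, θ)).toBlocks₁₁ = -secondMoment (steinFeature (p θ) f) Q := by
  ext i j
  exact meanHessian_inl_inl hU hT hθ hδ Q i j

/-- Ratio one means that `δ` is orthogonal to the feature at every point, so the second moment form
vanishes at `δ`; invertibility makes this form definite. -/
theorem eq_zero_of_ratio_eq_one (hU : IsOpen U)
    (hT : ∀ x, ContDiffOn ℝ 2 (fun θ => steinFeature (p θ) f x) U) {θ : Vec k} (hθ : θ ∈ U)
    {δ : Vec b} (hδ : ∀ x, ratio p f θ x δ = 1)
    (hint : ∀ i j, Integrable (fun x => hessian (logRatio p f x) (δ, θ) i j) Q)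
    (hunit : IsUnit (meanHessian p f Q (δ, θ)).toBlocks₁₁) : δ = 0 := by
  have hI := integrable_mul_steinFeature hU hT hθ hδ hint
  rw [meanHessian_toBlocks₁₁ hU hT hθ hδ, IsUnit.neg_iff] at hunit
  have hp := posDef_secondMoment hI hunit
  by_contra hne
  have hne' : δ.ofLp ≠ 0 := fun h => hne (by ext i; simpa using congrFun h i)
  have := hp.dotProduct_mulVec_pos hne'
  rw [star_trivial, ← integral_dotProduct_mul_dotProduct hI] at this
  have h0 : ∀ x, δ.ofLp ⬝ᵥ (steinFeature (p θ) f x).ofLp = 0 := fun x => by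
    have h := hδ x
    rw [ratio, add_eq_right, PiLp.inner_apply] at h
    rw [← h, dotProduct]
    exact Finset.sum_congr rfl fun i _ => by simp [mul_comm]
  simp [h0] at this

theorem meanHessian_eq_saddleMatrix (hU : IsOpen U)
    (hT : ∀ x, ContDiffOn ℝ 2 (fun θ => steinFeature (p θ) f x) U) {θ : Vec k} (hθ : θ ∈ U) :
    meanHessian p f Q (0, θ) = saddleMatrix (secondMoment (steinFeature (p θ) f) Q)
      (meanHessian p f Q (0, θ)).toBlocks₁₂ := by
  ext i j
  rcases i with i | i <;> rcases j with j | j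
  · exact meanHessian_inl_inl hU hT hθ (fun x => ratio_zero θ) Q i j
  · rfl
  · exact meanHessian_symm hU hT hθ Q _ _
  · exact meanHessian_inr_inr hU hT hθ Q i j

end Moments

/-! ### Measurability of the objective at the estimator. -/

section Measurability

variable {Ω : Type*} [MeasurableSpace Ω] {μ : Measure Ω} {d b k : ℕ} {p : Vec k → Vec d → ℝ}
  {f : Vec d → Vec b} {Θ : Set (Vec k)}

/-- The feature is a Carathéodory function on `Θ`: continuous in `θ` and measurable in `x`, hence
jointly measurable. Membership of `θ ω` in `Θ` for every `ω` allows corestriction to the subtype,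
and the real logarithm is measurable on all of `ℝ`, so positivity of the ratio plays no role. -/
theorem aemeasurable_objective (hc : ∀ θ ∈ Θ, Continuous (steinFeature (p θ) f))
    (hT : ∀ x, ContinuousOn (fun θ => steinFeature (p θ) f x) Θ)
    {X : ℕ → Ω → Vec d} (hX : ∀ i, AEMeasurable (X i) μ) {δ : Ω → Vec b} {θ : Ω → Vec k}
    (hδ : AEMeasurable δ μ) (hθ : AEMeasurable θ μ) (hmem : ∀ ω, θ ω ∈ Θ) (n : ℕ) :
    AEMeasurable (fun ω => objective p f n (fun i => X i ω) (δ ω, θ ω)) μ := by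
  have hu : Measurable (Function.uncurry fun (θ : Θ) x => steinFeature (p θ) f x) :=
    measurable_uncurry_of_continuous_of_measurable
      (fun x => continuousOn_iff_continuous_domRestrict.1 (hT x)) fun θ => (hc θ θ.2).measurable
  have hθ' : AEMeasurable (fun ω => (⟨θ ω, hmem ω⟩ : Θ)) μ := hθ.subtype_mk
  have h1 : ∀ i, AEMeasurable (fun ω => steinFeature (p (θ ω)) f (X i ω)) μ := fun i =>
    Measurable.comp_aemeasurable (f := fun ω => ((⟨θ ω, hmem ω⟩ : Θ), X i ω)) hu
      (hθ'.prodMk (hX i))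
  have h2 : ∀ i, AEMeasurable (fun ω => logRatio p f (X i ω) (δ ω, θ ω)) μ := fun i => by
    have h3 : AEMeasurable
        (fun ω => inner ℝ (δ ω) (steinFeature (p (θ ω)) f (X i ω)) + 1) μ :=
      (hδ.inner (h1 i)).add_const 1
    exact Real.measurable_log.comp_aemeasurable h3
  simp only [objective]
  exact (Finset.aemeasurable_fun_sum _ fun i _ => h2 i).const_mul _

end Measurability

/-! ### Uniform Hessian bounds and the deterministic expansion at the saddle point. -/

section Bounds

variable {b k : ℕ}

theorem norm_le_of_forall_abs_le {v : Vec b} {a : ℝ} (h : ∀ j, |v j| ≤ a) : ‖v‖ ≤ b * a := by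
  have hv : ∑ j, v j • (EuclideanSpace.single j (1 : ℝ) : Vec b) = v := by
    ext i
    simp [Pi.single_apply]
  rw [← hv]
  refine (norm_sum_le_of_le (f := fun j => v j • (EuclideanSpace.single j (1 : ℝ) : Vec b))
    Finset.univ fun j _ => ?_).trans_eq (by simp : ∑ _j : Fin b, a = b * a)
  simpa [norm_smul] using h j

theorem abs_apply_le_norm (v : Vec b) (j : Fin b) : |v j| ≤ ‖v‖ :=
  PiLp.norm_apply_le v j

theorem sum_abs_jointCoord_le (z : Vec b × Vec k) :
    ∑ i, |jointCoord z i| ≤ (b + k : ℝ) * ‖z‖ := by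
  have h : ∀ i, |jointCoord z i| ≤ ‖z‖ := fun i => by
    rcases i with i | i
    · exact (abs_apply_le_norm z.1 i).trans (norm_fst_le z)
    · exact (abs_apply_le_norm z.2 i).trans (norm_snd_le z)
  simpa using Finset.sum_le_card_nsmul Finset.univ _ _ fun i _ => h i

/-- A continuous function is bounded near a compact slice of a product. -/
theorem exists_bound_near_slice {A : Set (Vec b)} {Θ : Set (Vec k)} (hΘ : IsCompact Θ)
    (h0 : 0 ∈ A) {g : Vec b × Vec k → ℝ} (hg : ContinuousOn g (A ×ˢ Θ)) :
    ∃ B : ℝ, ∃ r : ℝ, 0 < r ∧ ∀ θ ∈ Θ, ∀ δ ∈ A, ‖δ‖ < r → |g (δ, θ)| ≤ B := by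
  -- The doubled intersection is the instance `s = Θ` of a property of `s ∩ Θ`, the form suited to
  -- compact induction: neighbourhoods taken in the whole space need not lie in `Θ`.
  have key : ∃ B : ℝ, ∃ r : ℝ, 0 < r ∧ ∀ θ ∈ Θ ∩ Θ, ∀ δ ∈ A, ‖δ‖ < r → |g (δ, θ)| ≤ B := by
    refine hΘ.induction_on
      (p := fun s => ∃ B : ℝ, ∃ r : ℝ, 0 < r ∧ ∀ θ ∈ s ∩ Θ, ∀ δ ∈ A, ‖δ‖ < r → |g (δ, θ)| ≤ B)
      ⟨0, 1, one_pos, by simp⟩ ?_ ?_ ?_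
    · rintro s t hst ⟨B, r, hr, h⟩
      exact ⟨B, r, hr, fun θ hθ => h θ ⟨hst hθ.1, hθ.2⟩⟩
    · rintro s t ⟨B, r, hr, h⟩ ⟨B', r', hr', h'⟩
      refine ⟨max B B', min r r', lt_min hr hr', fun θ hθ δ hδ hn => ?_⟩
      rcases hθ.1 with hs | ht
      · exact (h θ ⟨hs, hθ.2⟩ δ hδ (hn.trans_le (min_le_left _ _))).trans (le_max_left _ _)
      · exact (h' θ ⟨ht, hθ.2⟩ δ hδ (hn.trans_le (min_le_right _ _))).trans (le_max_right _ _)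
    · intro θ₀ hθ₀
      obtain ⟨ρ, hρ, h⟩ := Metric.continuousWithinAt_iff.1 (hg (0, θ₀) ⟨h0, hθ₀⟩) 1 one_pos
      refine ⟨Metric.ball θ₀ ρ, mem_nhdsWithin_of_mem_nhds (Metric.ball_mem_nhds _ hρ),
        |g (0, θ₀)| + 1, ρ, hρ, fun θ hθ δ hδ hn => ?_⟩
      have h1 := h (x := (δ, θ)) ⟨hδ, hθ.2⟩ (by
        rw [Prod.dist_eq]
        exact max_lt (by simpa using hn) hθ.1)
      rw [Real.dist_eq] at h1
      have h2 := abs_sub_abs_le_abs_sub (g (δ, θ)) (g (0, θ₀))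
      linarith
  simpa using key

theorem exists_bound_near_slice_matrix {ι : Type*} [Fintype ι] {A : Set (Vec b)} {Θ : Set (Vec k)}
    (hΘ : IsCompact Θ) (h0 : 0 ∈ A) {G : Vec b × Vec k → Matrix ι ι ℝ}
    (hG : ∀ i j, ContinuousOn (fun η => G η i j) (A ×ˢ Θ)) :
    ∃ B : ℝ, 0 ≤ B ∧ ∃ r : ℝ, 0 < r ∧
      ∀ θ ∈ Θ, ∀ δ ∈ A, ‖δ‖ < r → ∀ i j, |G (δ, θ) i j| ≤ B := by
  obtain ⟨B, r, hr, h⟩ := exists_bound_near_slice hΘ h0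
    (g := fun η => ∑ i, ∑ j, |G η i j|)
    (continuousOn_finsetSum _ fun i _ => continuousOn_finsetSum _ fun j _ => (hG i j).abs)
  refine ⟨max B 0, le_max_right _ _, r, hr, fun θ hθ δ hδ hn i j => ?_⟩
  calc |G (δ, θ) i j| ≤ ∑ j, |G (δ, θ) i j| :=
        Finset.single_le_sum (f := fun j => |G (δ, θ) i j|) (fun _ _ => abs_nonneg _)
          (Finset.mem_univ j)
    _ ≤ ∑ i, ∑ j, |G (δ, θ) i j| :=
        Finset.single_le_sum (f := fun i => ∑ j, |G (δ, θ) i j|)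
          (fun _ _ => Finset.sum_nonneg fun _ _ => abs_nonneg _) (Finset.mem_univ i)
    _ ≤ B := (le_abs_self _).trans (h θ hθ δ hδ hn)
    _ ≤ _ := le_max_left _ _

theorem exists_matrix_near {ι : Type*} [Finite ι] {A : Set (Vec b)} {Θ : Set (Vec k)}
    (h0 : 0 ∈ A) {θs : Vec k} (hθs : θs ∈ Θ) {G : Vec b × Vec k → Matrix ι ι ℝ}
    (hG : ∀ i j, ContinuousOn (fun η => G η i j) (A ×ˢ Θ)) {ε : ℝ} (hε : 0 < ε) :
    ∃ r : ℝ, 0 < r ∧ ∀ δ ∈ A, ∀ θ ∈ Θ, ‖δ‖ < r → ‖θ - θs‖ < r →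
      ∀ i j, |G (δ, θ) i j - G (0, θs) i j| ≤ ε := by
  have h : ∀ᶠ η in 𝓝[A ×ˢ Θ] (0, θs), ∀ i j, |G η i j - G (0, θs) i j| < ε :=
    eventually_all.2 fun i => eventually_all.2 fun j =>
      Metric.tendsto_nhds.1 (hG i j (0, θs) ⟨h0, hθs⟩) ε hε
  obtain ⟨r, hr, h⟩ := Metric.mem_nhdsWithin_iff.1 h
  refine ⟨r, hr, fun δ hδ θ hθ h1 h2 i j => ?_⟩
  have hmem : (δ, θ) ∈ Metric.ball ((0 : Vec b), θs) r ∩ A ×ˢ Θ := by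
    refine ⟨?_, hδ, hθ⟩
    rw [Metric.mem_ball, Prod.dist_eq]
    exact max_lt (by simpa using h1) (by simpa [dist_eq_norm] using h2)
  exact (h hmem i j).le

variable {F : Vec b × Vec k → ℝ} {Δ : Set (Vec b)} {Θ : Set (Vec k)}

theorem segment_mem (hΔ : Convex ℝ Δ) (hΘ : Convex ℝ Θ) {a c : Vec b × Vec k}
    (ha : a ∈ Δ ×ˢ Θ) (hc : c ∈ Δ ×ˢ Θ) {t : ℝ} (ht : t ∈ Set.Icc (0 : ℝ) 1) :
    a + t • (c - a) ∈ Δ ×ˢ Θ :=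
  (hΔ.prod hΘ).add_smul_sub_mem ha hc ht

/-- Gradients are Lipschitz along segments with bounded Hessian. -/
theorem abs_fderiv_sub_le_of_bound {a c : Vec b × Vec k} {B : ℝ} (hB : 0 ≤ B)
    (hF : ∀ t ∈ Set.Icc (0 : ℝ) 1, ContDiffAt ℝ 2 F (a + t • (c - a)))
    (hH : ∀ t ∈ Set.Icc (0 : ℝ) 1, ∀ i j, |hessian F (a + t • (c - a)) i j| ≤ B)
    (j : Fin b ⊕ Fin k) :
    |fderiv ℝ F c (coordVec j) - fderiv ℝ F a (coordVec j)| ≤ B * ((b + k : ℝ) * ‖c - a‖) := by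
  have h := abs_fderiv_sub_le (M := 0) hF (by simpa using hH) j
  simp only [Matrix.zero_apply, mul_zero, Finset.sum_const_zero, sub_zero] at h
  exact h.trans (mul_le_mul_of_nonneg_left (sum_abs_jointCoord_le _) hB)

/-- Expansion of the first order conditions and of the objective around the true parameter. -/
theorem saddle_expansion (hΔ : Convex ℝ Δ) (hΘ : Convex ℝ Θ)
    (hF : ∀ δ ∈ Δ, ∀ θ ∈ Θ, ContDiffAt ℝ 2 F (δ, θ)) {δ : Vec b} {θ θs : Vec k}
    (h0 : 0 ∈ Δ) (hδ : δ ∈ Δ) (hθs : θs ∈ Θ) (hθ : θ ∈ Θ) (hcrit : fderiv ℝ F (δ, θ) = 0)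
    {M : Matrix (Fin b ⊕ Fin k) (Fin b ⊕ Fin k) ℝ} {r ε : ℝ} (hε : 0 ≤ ε)
    (hM : ∀ δ ∈ Δ, ∀ θ ∈ Θ, ‖δ‖ < r → ‖θ - θs‖ < r →
      ∀ i j, |hessian F (δ, θ) i j - M i j| ≤ ε)
    (hδr : ‖δ‖ < r) (hθr : ‖θ - θs‖ < r) (hF0 : F (0, θs) = 0) {s : Fin b → ℝ}
    (hs : ∀ j, fderiv ℝ F (0, θs) (coordVec (Sum.inl j)) = s j)
    (hs' : ∀ j, fderiv ℝ F (0, θs) (coordVec (Sum.inr j)) = 0) :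
    ‖jointCoord ((δ, θ) - (0, θs)) ᵥ* M + Sum.elim s 0‖
        ≤ ε * (b + k + 1) ^ 2 * ‖jointCoord ((δ, θ) - (0, θs))‖ ∧
      |F (δ, θ) + 2⁻¹ * ((jointCoord ((δ, θ) - (0, θs)) ᵥ* M)
          ⬝ᵥ jointCoord ((δ, θ) - (0, θs)))|
        ≤ ε * (b + k + 1) ^ 2 * ‖jointCoord ((δ, θ) - (0, θs))‖ ^ 2 := by
  set a : Vec b × Vec k := (0, θs)
  set c : Vec b × Vec k := (δ, θ)
  have hseg : ∀ t ∈ Set.Icc (0 : ℝ) 1, a + t • (c - a) ∈ Δ ×ˢ Θ := fun t ht =>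
    segment_mem hΔ hΘ ⟨h0, hθs⟩ ⟨hδ, hθ⟩ ht
  have hFs : ∀ t ∈ Set.Icc (0 : ℝ) 1, ContDiffAt ℝ 2 F (a + t • (c - a)) := fun t ht =>
    hF _ (hseg t ht).1 _ (hseg t ht).2
  have hMs : ∀ t ∈ Set.Icc (0 : ℝ) 1, ∀ i j, |hessian F (a + t • (c - a)) i j - M i j| ≤ ε :=
    fun t ht => by
      refine hM _ (hseg t ht).1 _ (hseg t ht).2 ?_ ?_
      · have : (a + t • (c - a)).1 = t • δ := by simp [a, c]
        rw [this, norm_smul, Real.norm_eq_abs, abs_of_nonneg ht.1]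
        exact (mul_le_of_le_one_left (norm_nonneg _) ht.2).trans_lt hδr
      · have : (a + t • (c - a)).2 - θs = t • (θ - θs) := by simp [a, c]
        refine lt_of_eq_of_lt (congrArg norm this) ?_
        rw [norm_smul, Real.norm_eq_abs, abs_of_nonneg ht.1]
        exact (mul_le_of_le_one_left (norm_nonneg _) ht.2).trans_lt hθr
  set z := jointCoord (c - a)
  have hz : ∑ i, |z i| ≤ (b + k : ℝ) * ‖z‖ := by
    simpa using Finset.sum_le_card_nsmul Finset.univ (fun i => |z i|) ‖z‖
      fun i _ => norm_le_pi_norm z i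
  have hb : (0 : ℝ) ≤ b := Nat.cast_nonneg _
  have hk : (0 : ℝ) ≤ k := Nat.cast_nonneg _
  constructor
  · refine (pi_norm_le_iff_of_nonneg (by positivity)).2 fun j => ?_
    have h := abs_fderiv_sub_le hFs hMs j
    have hj : fderiv ℝ F a (coordVec j) = Sum.elim s 0 j := by
      rcases j with j | j
      · exact hs j
      · exact hs' j
    rw [hcrit, hj, _root_.zero_apply, ← abs_neg] at h
    calc ‖(z ᵥ* M + Sum.elim s 0 : Fin b ⊕ Fin k → ℝ) j‖
        = |-(0 - Sum.elim s 0 j - ∑ i, z i * M i j)| := by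
          rw [Real.norm_eq_abs, Pi.add_apply]
          congr 1
          simp only [Matrix.vecMul, dotProduct]
          ring
      _ ≤ ε * ∑ i, |z i| := h
      _ ≤ ε * ((b + k : ℝ) * ‖z‖) := mul_le_mul_of_nonneg_left hz hε
      -- The factor `(b + k + 1) ^ 2` dominates both `b + k` here and `(b + k) ^ 2` in the quadratic
      -- bound, so one constant serves both.
      _ ≤ ε * ((b + k + 1) ^ 2 * ‖z‖) := by
          gcongr
          nlinarith
      _ = _ := by ring
  · have h := abs_sub_add_half_quadratic_le hFs hMs fun j => by rw [hcrit]; rfl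
    rw [hF0, sub_zero] at h
    refine h.trans ?_
    calc ε * (∑ i, |z i|) ^ 2 ≤ ε * ((b + k : ℝ) * ‖z‖) ^ 2 := by
          gcongr
      _ ≤ ε * ((b + k + 1 : ℝ) * ‖z‖) ^ 2 := by
          gcongr ε * (?_ * ‖z‖) ^ 2
          linarith
      _ = _ := by ring

end Bounds

/-! ### Uniform separation from zero over a compact set. -/

section Separation

variable {Ω : Type*} [MeasurableSpace Ω] {μ : Measure Ω} {E G : Type*} [NormedAddCommGroup E]
  [NormedAddCommGroup G]

/-- Equi-Lipschitz random functions converging in probability at each point of a compact set to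
nonzero limits are bounded away from zero on it with high probability. -/
theorem exists_highProb_le_norm {K : Set E} (hK : IsCompact K) {S : ℕ → Ω → E → G} {m : E → G}
    (hm : ∀ θ ∈ K, m θ ≠ 0) {L : ℝ} (hL : 0 ≤ L)
    (hLip : HighProb μ fun n ω => ∀ θ ∈ K, ∀ θ' ∈ K, ‖S n ω θ - S n ω θ'‖ ≤ L * ‖θ - θ'‖)
    (hlln : ∀ θ ∈ K, ∀ ε, 0 < ε → HighProb μ fun n ω => ‖S n ω θ - m θ‖ < ε) :
    ∃ c : ℝ, 0 < c ∧ HighProb μ fun n ω => ∀ θ ∈ K, c ≤ ‖S n ω θ‖ := by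
  have key : ∃ c : ℝ, 0 < c ∧ HighProb μ fun n ω => ∀ θ ∈ K ∩ K, c ≤ ‖S n ω θ‖ := by
    refine hK.induction_on
      (p := fun s => ∃ c : ℝ, 0 < c ∧ HighProb μ fun n ω => ∀ θ ∈ s ∩ K, c ≤ ‖S n ω θ‖)
      ⟨1, one_pos, by simp [HighProb]⟩ ?_ ?_ ?_
    · rintro s t hst ⟨c, hc, h⟩
      exact ⟨c, hc, h.mp fun n ω h θ hθ => h θ ⟨hst hθ.1, hθ.2⟩⟩
    · rintro s t ⟨c, hc, h⟩ ⟨c', hc', h'⟩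
      refine ⟨min c c', lt_min hc hc', (h.and h').mp fun n ω h θ hθ => ?_⟩
      rcases hθ.1 with hs | ht
      · exact (min_le_left _ _).trans (h.1 θ ⟨hs, hθ.2⟩)
      · exact (min_le_right _ _).trans (h.2 θ ⟨ht, hθ.2⟩)
    · intro θ₀ hθ₀
      -- One third of the limit is lost to the law of large numbers at `θ₀`, one third to the
      -- Lipschitz variation on the ball, and one third remains. The radius uses `L + 1` because `L`
      -- may be zero.
      set c := ‖m θ₀‖ / 3
      have hc : 0 < c := div_pos (norm_pos_iff.2 (hm θ₀ hθ₀)) (by norm_num)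
      have hcm : ‖m θ₀‖ = 3 * c := by simp only [c]; ring
      refine ⟨Metric.ball θ₀ (c / (L + 1)), mem_nhdsWithin_of_mem_nhds
        (Metric.ball_mem_nhds _ (by positivity)), c, hc,
        (hLip.and (hlln θ₀ hθ₀ c hc)).mp fun n ω h θ hθ => ?_⟩
      have h1 := h.1 θ₀ hθ₀ θ hθ.2
      have h2 : L * ‖θ₀ - θ‖ ≤ c := by
        have h3 : ‖θ₀ - θ‖ < c / (L + 1) := by
          rw [norm_sub_rev, ← dist_eq_norm]
          exact hθ.1
        rw [lt_div_iff₀ (by positivity)] at h3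
        nlinarith [norm_nonneg (θ₀ - θ)]
      have h4 := norm_sub_norm_le (m θ₀) (S n ω θ₀)
      have h5 := norm_sub_norm_le (S n ω θ₀) (S n ω θ)
      rw [norm_sub_rev] at h4
      linarith [h.2]
  simpa using key

end Separation

/-! ### Consistency of the estimator and the stochastic expansion. -/

section Consistency

variable {d b k : ℕ} {p : Vec k → Vec d → ℝ} {f : Vec d → Vec b} {U Θ : Set (Vec k)}

/-- An interior min-max point of a smooth objective which is strongly concave in `δ`. -/
structure IsRegularMinMax (F : Vec b × Vec k → ℝ) (Δ : Set (Vec b)) (Θ : Set (Vec k)) (c : ℝ)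
    (δ : Vec b) (θ : Vec k) : Prop where
  contDiffAt : ∀ δ ∈ Δ, ∀ θ ∈ Θ, ContDiffAt ℝ 2 F (δ, θ)
  concave : ∀ δ ∈ Δ, ∀ θ ∈ Θ, (-(hessian F (δ, θ)).toBlocks₁₁
    - c • (1 : Matrix (Fin b) (Fin b) ℝ)).PosSemidef
  minMax : IsInteriorMinMax F Δ Θ δ θ

theorem IsRegularMinMax.mem {F : Vec b × Vec k → ℝ} {Δ : Set (Vec b)} {c : ℝ} {δ : Vec b}
    {θ : Vec k} (h : IsRegularMinMax F Δ Θ c δ θ) : δ ∈ Δ ∧ θ ∈ Θ :=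
  ⟨interior_subset h.minMax.mem_interior_ratio, interior_subset h.minMax.mem_interior_param⟩

theorem IsRegularMinMax.fderiv_eq_zero {F : Vec b × Vec k → ℝ} {Δ : Set (Vec b)} {c : ℝ}
    {δ : Vec b} {θ : Vec k} (h : IsRegularMinMax F Δ Θ c δ θ) (hΔ : Convex ℝ Δ) (hc : 0 < c) :
    fderiv ℝ F (δ, θ) = 0 :=
  h.minMax.fderiv_eq_zero hΔ hc h.contDiffAt h.concave

theorem IsRegularMinMax.norm_le (hU : IsOpen U) (hΘU : Θ ⊆ U)
    (hT : ∀ x, ContDiffOn ℝ 2 (fun θ => steinFeature (p θ) f x) U) {n : ℕ} {y : ℕ → Vec d}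
    {Δ : Set (Vec b)} {c : ℝ} {δ : Vec b} {θ : Vec k}
    (h : IsRegularMinMax (objective p f n y) Δ Θ c δ θ) (hΔ : Convex ℝ Δ) (hc : 0 < c)
    (h0 : 0 ∈ Δ) {θs : Vec k} (hθs : θs ∈ Θ) : ‖δ‖ ≤ ‖sampleStein p f n y θs‖ / c := by
  have h1 := h.minMax.norm_sq_le hΔ hc h.contDiffAt h.concave h0 (fun θ _ => objective_zero θ) hθs
  simp only [fderiv_objective_zero_inl hU hT (hΘU hθs)] at h1
  rw [← EuclideanSpace.real_norm_sq_eq, ← div_pow] at h1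
  exact (sq_le_sq₀ (norm_nonneg _) (by positivity)).1 h1

/-- The sample Stein mean is the `δ`-gradient of the objective at `(0, θ)`, so a Hessian bound on
the slice is a Lipschitz bound. This supplies the equicontinuity for separation. -/
theorem norm_sampleStein_sub_le (hU : IsOpen U) (hΘU : Θ ⊆ U) (hΘ : Convex ℝ Θ)
    (hT : ∀ x, ContDiffOn ℝ 2 (fun θ => steinFeature (p θ) f x) U) {n : ℕ} {y : ℕ → Vec d}
    {B : ℝ} (hB : 0 ≤ B)
    (hH : ∀ θ ∈ Θ, ∀ i j, |hessian (objective p f n y) (0, θ) i j| ≤ B)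
    {θ θ' : Vec k} (hθ : θ ∈ Θ) (hθ' : θ' ∈ Θ) :
    ‖sampleStein p f n y θ - sampleStein p f n y θ'‖ ≤ b * (B * (b + k)) * ‖θ - θ'‖ := by
  have hseg : ∀ t ∈ Set.Icc (0 : ℝ) 1,
      ∃ θ₁ ∈ Θ, ((0 : Vec b), θ') + t • (((0 : Vec b), θ) - (0, θ')) = (0, θ₁) := fun t ht =>
    ⟨_, hΘ.add_smul_sub_mem hθ' hθ ht, by simp⟩
  rw [mul_assoc]
  refine norm_le_of_forall_abs_le fun j => ?_
  have h := abs_fderiv_sub_le_of_bound (F := objective p f n y) (a := ((0 : Vec b), θ'))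
    (c := (0, θ)) hB
    (fun t ht => by
      obtain ⟨θ₁, h₁, e⟩ := hseg t ht
      rw [e]
      exact contDiffAt_objective hU hT (hΘU h₁) fun i _ => by simp [ratio_zero])
    (fun t ht => by
      obtain ⟨θ₁, h₁, e⟩ := hseg t ht
      rw [e]
      exact hH θ₁ h₁) (Sum.inl j)
  rw [fderiv_objective_zero_inl hU hT (hΘU hθ), fderiv_objective_zero_inl hU hT (hΘU hθ')] at h
  refine h.trans_eq ?_
  have : ‖((0 : Vec b), θ) - (0, θ')‖ = ‖θ - θ'‖ := by simp [Prod.norm_def]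
  rw [this]
  ring

/-- The gradient vanishes at `(δ, θ)`, so at `(0, θ)` it is at most the Hessian bound times the
distance between the two points. -/
theorem IsRegularMinMax.norm_sampleStein_le (hU : IsOpen U) (hΘU : Θ ⊆ U)
    (hT : ∀ x, ContDiffOn ℝ 2 (fun θ => steinFeature (p θ) f x) U) {n : ℕ} {y : ℕ → Vec d}
    {Δ : Set (Vec b)} {c : ℝ} {δ : Vec b} {θ : Vec k}
    (h : IsRegularMinMax (objective p f n y) Δ Θ c δ θ) (hΔ : Convex ℝ Δ) (hc : 0 < c)
    (h0 : 0 ∈ Δ) {B r : ℝ} (hB : 0 ≤ B)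
    (hH : ∀ δ ∈ Δ, ∀ θ ∈ Θ, ‖δ‖ < r → ∀ i j, |hessian (objective p f n y) (δ, θ) i j| ≤ B)
    (hr : ‖δ‖ < r) : ‖sampleStein p f n y θ‖ ≤ b * (B * (b + k)) * ‖δ‖ := by
  have hseg : ∀ t ∈ Set.Icc (0 : ℝ) 1,
      ∃ δ₁ ∈ Δ, ‖δ₁‖ < r ∧ ((0 : Vec b), θ) + t • ((δ, θ) - (0, θ)) = (δ₁, θ) := fun t ht => by
    refine ⟨t • δ, ?_, ?_, by simp⟩
    · simpa using hΔ.add_smul_sub_mem h0 h.mem.1 ht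
    · rw [norm_smul, Real.norm_eq_abs, abs_of_nonneg ht.1]
      exact (mul_le_of_le_one_left (norm_nonneg _) ht.2).trans_lt hr
  rw [mul_assoc]
  refine norm_le_of_forall_abs_le fun j => ?_
  have hl := abs_fderiv_sub_le_of_bound (F := objective p f n y) (a := ((0 : Vec b), θ))
    (c := (δ, θ)) hB
    (fun t ht => by
      obtain ⟨δ₁, h₁, _, e⟩ := hseg t ht
      rw [e]
      exact h.contDiffAt _ h₁ _ h.mem.2)
    (fun t ht => by
      obtain ⟨δ₁, h₁, h₂, e⟩ := hseg t ht
      rw [e]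
      exact hH _ h₁ _ h.mem.2 h₂) (Sum.inl j)
  rw [fderiv_objective_zero_inl hU hT (hΘU h.mem.2), h.fderiv_eq_zero hΔ hc, _root_.zero_apply,
    zero_sub, abs_neg] at hl
  refine hl.trans_eq ?_
  have : ‖(δ, θ) - ((0 : Vec b), θ)‖ = ‖δ‖ := by simp [Prod.norm_def]
  rw [this]
  ring

variable {Ω : Type*} [MeasurableSpace Ω] {μ : Measure Ω} [IsProbabilityMeasure μ]
  {Q : Measure (Vec d)} {X : ℕ → Ω → Vec d} {Δ : ℕ → Ω → Set (Vec b)} {θs : Vec k}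
  {δhat : ℕ → Ω → Vec b} {θhat : ℕ → Ω → Vec k} {c : ℝ}

theorem highProb_hessian_bound (hΘ : IsCompact Θ) (h0 : ∀ n ω, 0 ∈ Δ n ω)
    (hunif : UniformHessianConvergence μ p f Q X Θ Δ) :
    ∃ B : ℝ, 0 ≤ B ∧ ∃ r : ℝ, 0 < r ∧ HighProb μ fun n ω => ∀ δ ∈ Δ n ω, ∀ θ ∈ Θ, ‖δ‖ < r →
      ∀ i j, |hessian (objective p f n fun i => X i ω) (δ, θ) i j| ≤ B := by
  have hΩ : Nonempty Ω := nonempty_of_isProbabilityMeasure μ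
  obtain ⟨ω₀⟩ := hΩ
  obtain ⟨B, hB, r, hr, h⟩ := exists_bound_near_slice_matrix hΘ
    (Set.mem_iUnion.2 ⟨0, Set.mem_iUnion.2 ⟨ω₀, h0 0 ω₀⟩⟩) hunif.continuousOn
  refine ⟨B + 1, by linarith, r, hr,
    (HighProb.forall fun i => HighProb.forall fun j => hunif.tendsto i j 1 one_pos).mp
      fun n ω hω δ hδ θ hθ hn i j => ?_⟩
  have h1 := hω i j δ hδ θ hθ
  have h2 := h θ hθ δ (Set.mem_iUnion.2 ⟨n, Set.mem_iUnion.2 ⟨ω, hδ⟩⟩) hn i j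
  have h3 := abs_sub_abs_le_abs_sub (hessian (objective p f n fun i => X i ω) (δ, θ) i j)
    (meanHessian p f Q (δ, θ) i j)
  linarith

/-- Consistency of the min-max estimator. -/
theorem highProb_estimator_near (hlaw : ∀ i, HasLaw (X i) Q μ) (hindep : iIndepFun X μ)
    (hΘ : IsCompact Θ) (hΘc : Convex ℝ Θ) (hΔ : ∀ n ω, Convex ℝ (Δ n ω))
    (hU : IsOpen U) (hΘU : Θ ⊆ U)
    (hT : ∀ x, ContDiffOn ℝ 2 (fun θ => steinFeature (p θ) f x) U)
    (hcont : ∀ θ ∈ Θ, Continuous (steinFeature (p θ) f))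
    (hint : ∀ θ ∈ Θ, Integrable (steinFeature (p θ) f) Q) (h0 : ∀ n ω, 0 ∈ Δ n ω)
    (hθs : θs ∈ Θ) (hstein : ∫ x, steinFeature (p θs) f x ∂Q = 0)
    (hident : ∀ θ ∈ Θ, (∫ x, steinFeature (p θ) f x ∂Q) = 0 → θ = θs)
    (hunif : UniformHessianConvergence μ p f Q X Θ Δ) (hc : 0 < c)
    (hreg : HighProb μ fun n ω => IsRegularMinMax (objective p f n fun i => X i ω) (Δ n ω) Θ c
      (δhat n ω) (θhat n ω)) {ρ : ℝ} (hρ : 0 < ρ) :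
    HighProb μ fun n ω => ‖δhat n ω‖ < ρ ∧ ‖θhat n ω - θs‖ < ρ := by
  obtain ⟨B, hB, r, hr, hbound⟩ := highProb_hessian_bound hΘ h0 hunif
  have hlln : ∀ θ ∈ Θ, ∀ ε, 0 < ε → HighProb μ fun n ω =>
      ‖sampleStein p f n (fun i => X i ω) θ - ∫ x, steinFeature (p θ) f x ∂Q‖ < ε :=
    fun θ hθ ε hε =>
      highProb_norm_sampleMean_sub_lt hlaw hindep (hcont θ hθ).measurable (hint θ hθ) hε
  set L : ℝ := b * (B * (b + k)) with hL
  have hL0 : 0 ≤ L := by positivity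
  have hsub : {θ ∈ Θ | ρ ≤ ‖θ - θs‖} ⊆ Θ := Set.sep_subset _ _
  have hK : IsCompact {θ ∈ Θ | ρ ≤ ‖θ - θs‖} :=
    hΘ.inter_right (isClosed_le continuous_const (continuous_id.sub continuous_const).norm)
  obtain ⟨a, ha, hsep⟩ := exists_highProb_le_norm (μ := μ) hK
    (S := fun n ω θ => sampleStein p f n (fun i => X i ω) θ)
    (m := fun θ => ∫ x, steinFeature (p θ) f x ∂Q)
    (fun θ hθ h => by
      have := hident θ hθ.1 h
      have h2 := hθ.2
      rw [this, sub_self, norm_zero] at h2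
      linarith) hL0
    (hbound.mp fun n ω h θ hθ θ' hθ' => norm_sampleStein_sub_le hU hΘU hΘc hT hB
      (fun θ hθ => h 0 (h0 n ω) θ hθ (by simpa using hr)) (hsub hθ) (hsub hθ'))
    (fun θ hθ => hlln θ (hsub hθ))
  have hL1 : 0 < L + 1 := by linarith
  -- A bound `τ` on `δhat` gives the claim for `δhat` through `ρ`, validity of the Hessian bound
  -- through `r`, and through the last term a sample Stein mean at `θhat` smaller than the
  -- separation constant `a`.
  set τ := min (min ρ r) (a / (L + 1)) with hτ
  have hτ0 : 0 < τ := lt_min (lt_min hρ hr) (by positivity)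
  have hS := hlln θs hθs (c * τ) (by positivity)
  rw [hstein] at hS
  refine (((hreg.and hbound).and hsep).and hS).mp fun n ω h => ?_
  obtain ⟨⟨⟨h1, h2⟩, h3⟩, h4⟩ := h
  rw [sub_zero] at h4
  have hδ : ‖δhat n ω‖ < τ := by
    refine (h1.norm_le hU hΘU hT (hΔ n ω) hc (h0 n ω) hθs).trans_lt ?_
    rw [div_lt_iff₀ hc]
    linarith
  refine ⟨hδ.trans_le ((min_le_left _ _).trans (min_le_left _ _)), ?_⟩
  by_contra hcon
  have h5 := h3 (θhat n ω) ⟨h1.mem.2, not_lt.1 hcon⟩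
  have h6 := h1.norm_sampleStein_le hU hΘU hT (hΔ n ω) hc (h0 n ω) hB h2
    (hδ.trans_le ((min_le_left _ _).trans (min_le_right _ _)))
  have h7 : ‖δhat n ω‖ < a / (L + 1) := hδ.trans_le (min_le_right _ _)
  rw [lt_div_iff₀ hL1] at h7
  nlinarith [norm_nonneg (δhat n ω)]

/-- Quadratic approximation of the objective at the estimator, with relative error. -/
theorem highProb_objective_expansion (hΘc : Convex ℝ Θ) (hΔ : ∀ n ω, Convex ℝ (Δ n ω))
    (hU : IsOpen U) (hΘU : Θ ⊆ U)
    (hT : ∀ x, ContDiffOn ℝ 2 (fun θ => steinFeature (p θ) f x) U) (h0 : ∀ n ω, 0 ∈ Δ n ω)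
    (hθs : θs ∈ Θ) (hunif : UniformHessianConvergence μ p f Q X Θ Δ) (hc : 0 < c)
    (hreg : HighProb μ fun n ω => IsRegularMinMax (objective p f n fun i => X i ω) (Δ n ω) Θ c
      (δhat n ω) (θhat n ω))
    (hcons : ∀ ρ, 0 < ρ → HighProb μ fun n ω => ‖δhat n ω‖ < ρ ∧ ‖θhat n ω - θs‖ < ρ)
    {ε : ℝ} (hε : 0 < ε) :
    HighProb μ fun n ω => ∃ z : Fin b ⊕ Fin k → ℝ,
      ‖z ᵥ* meanHessian p f Q (0, θs)
        + Sum.elim (sampleStein p f n (fun i => X i ω) θs).ofLp 0‖ ≤ ε * ‖z‖ ∧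
      |objective p f n (fun i => X i ω) (δhat n ω, θhat n ω)
        + 2⁻¹ * ((z ᵥ* meanHessian p f Q (0, θs)) ⬝ᵥ z)| ≤ ε * ‖z‖ ^ 2 := by
  obtain ⟨ω₀⟩ : Nonempty Ω := nonempty_of_isProbabilityMeasure μ
  -- Two errors of size `ε'` add up, the uniform deviation of the sample Hessian and the modulus of
  -- continuity of its mean; the expansion then costs `(b + k + 1) ^ 2`.
  set ε' := ε / (2 * (b + k + 1) ^ 2) with hε'
  have hε0 : 0 < ε' := by positivity
  have hεε : (ε' + ε') * (b + k + 1) ^ 2 = ε := by rw [hε']; field_simp; ring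
  obtain ⟨r, hr, hnear⟩ := exists_matrix_near
    (Set.mem_iUnion.2 ⟨0, Set.mem_iUnion.2 ⟨ω₀, h0 0 ω₀⟩⟩) hθs hunif.continuousOn hε0
  refine ((hreg.and (hcons r hr)).and (HighProb.forall fun i => HighProb.forall fun j =>
    hunif.tendsto i j ε' hε0)).mp fun n ω h => ?_
  obtain ⟨⟨h1, h2⟩, h3⟩ := h
  refine ⟨jointCoord ((δhat n ω, θhat n ω) - (0, θs)), ?_⟩
  have := saddle_expansion (hΔ n ω) hΘc h1.contDiffAt (h0 n ω) h1.mem.1 hθs h1.mem.2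
    (h1.fderiv_eq_zero (hΔ n ω) hc) (M := meanHessian p f Q (0, θs)) (r := r)
    (ε := ε' + ε') (by positivity)
    (fun δ hδ θ hθ hδr hθr i j => (abs_sub_le _ (meanHessian p f Q (δ, θ) i j) _).trans
      (add_le_add (h3 i j δ hδ θ hθ)
        (hnear δ (Set.mem_iUnion.2 ⟨n, Set.mem_iUnion.2 ⟨ω, hδ⟩⟩) θ hθ hδr hθr i j)))
    h2.1 h2.2 (objective_zero θs)
    (fun j => fderiv_objective_zero_inl hU hT (hΘU hθs) j)
    (fun j => fderiv_objective_zero_inr hU hT (hΘU hθs) j)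
  rwa [hεε] at this

end Consistency

/-! ### Normalization of the quadratic statistic and proof of the limit theorem. -/

theorem sampleStein_ofLp {d b k : ℕ} (p : Vec k → Vec d → ℝ) (f : Vec d → Vec b) (n : ℕ)
    (y : ℕ → Vec d) (θ : Vec k) : (sampleStein p f n y θ).ofLp
      = fun j => (n : ℝ)⁻¹ * ∑ i ∈ Finset.range n, steinFeature (p θ) f (y i) j := by
  ext j
  simp [sampleStein]

theorem mul_sum_dotProduct_sampleStein_sq {d b k m : ℕ} (p : Vec k → Vec d → ℝ)
    (f : Vec d → Vec b) (n : ℕ) (y : ℕ → Vec d) (θ : Vec k) (e : Fin m → Fin b → ℝ) :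
    n * ∑ l, (e l ⬝ᵥ (sampleStein p f n y θ).ofLp) ^ 2
      = ∑ l, ((√n)⁻¹ * ∑ i ∈ Finset.range n, e l ⬝ᵥ (steinFeature (p θ) f (y i)).ofLp) ^ 2 := by
  rw [Finset.mul_sum]
  refine Finset.sum_congr rfl fun l _ => ?_
  have h : e l ⬝ᵥ (sampleStein p f n y θ).ofLp
      = (n : ℝ)⁻¹ * ∑ i ∈ Finset.range n, e l ⬝ᵥ (steinFeature (p θ) f (y i)).ofLp := by
    rw [sampleStein, WithLp.ofLp_smul, dotProduct_smul, WithLp.ofLp_sum, dotProduct_sum]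
    rfl
  rw [h, mul_pow, mul_pow, inv_pow (√(n : ℝ)), Real.sq_sqrt (Nat.cast_nonneg n), ← mul_assoc]
  rcases n.eq_zero_or_pos with rfl | hn
  · simp
  · have : (n : ℝ) ≠ 0 := (Nat.cast_pos.2 hn).ne'
    congr 1
    field_simp

end DLE

open DLE in
theorem mainTheorem6
    {Ω : Type*} [MeasurableSpace Ω] (μ : Measure Ω) [IsProbabilityMeasure μ]
    {d b k : ℕ}
    (p : DLE.Vec k → DLE.Vec d → ℝ) (f : DLE.Vec d → DLE.Vec b)
    (q : DLE.Vec d → ℝ) (Q : Measure (DLE.Vec d))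
    (hQ : Q = volume.withDensity fun x => ENNReal.ofReal (q x))
    (X : ℕ → Ω → DLE.Vec d) (hlaw : ∀ i, HasLaw (X i) Q μ) (hindep : iIndepFun X μ)
    -- the parameter spaces
    (Θ U : Set (DLE.Vec k)) (Δ : ℕ → Ω → Set (DLE.Vec b))
    (hΘ_compact : IsCompact Θ) (hΘ_convex : Convex ℝ Θ)
    (hΔ_compact : ∀ n ω, IsCompact (Δ n ω)) (hΔ_convex : ∀ n ω, Convex ℝ (Δ n ω))
    -- regularity of the model and of the features
    (hdensity : ∀ θ ∈ Θ, DLE.IsPosDensity (p θ))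
    (hstein : ∀ θ ∈ Θ, DLE.SteinRegular (p θ) f)
    (hU_open : IsOpen U) (hΘU : Θ ⊆ U)
    (hsmooth : ∀ x, ContDiffOn ℝ 2 (fun θ => DLE.steinFeature (p θ) f x) U)
    (hratio : DLE.HighProb μ fun n ω =>
      ∀ δ ∈ Δ n ω, ∀ θ ∈ Θ, ∀ i < n, 0 < DLE.ratio p f θ (X i ω) δ)
    -- the estimator
    (δhat : ℕ → Ω → DLE.Vec b) (θhat : ℕ → Ω → DLE.Vec k)
    (hδhat_meas : ∀ n, AEMeasurable (δhat n) μ) (hθhat_meas : ∀ n, AEMeasurable (θhat n) μ)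
    (hδhat_mem : ∀ n ω, δhat n ω ∈ Δ n ω) (hθhat_mem : ∀ n ω, θhat n ω ∈ Θ)
    (hestimator : DLE.HighProb μ fun n ω =>
      DLE.IsInteriorMinMax (DLE.objective p f n fun i => X i ω) (Δ n ω) Θ (δhat n ω) (θhat n ω))
    -- correct specification, and identification of the true parameter by the features
    (θs : DLE.Vec k) (δs : DLE.Vec b)
    (hmodel : DLE.CorrectModel p f q Θ Δ θs δs)
    (hident : ∀ θ ∈ Θ, (∫ x, DLE.steinFeature (p θ) f x ∂Q) = 0 → θ = θs)
    -- the remaining assumptions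
    (hbounds : DLE.UniformHessianBounds μ p f X Θ Δ)
    (hconc : DLE.SteinConcentration μ p f Q X θs)
    (hunif : DLE.UniformHessianConvergence μ p f Q X Θ Δ)
    (hinv : IsUnit (DLE.meanHessian p f Q (δs, θs)).toBlocks₁₁)
    (hrank : (DLE.meanHessian p f Q (δs, θs)).toBlocks₁₂.rank = min b k)
    (hdim : k < b) :
    TendstoInDistribution
      (fun (n : ℕ) ω => 2 * (n : ℝ) *
        DLE.objective p f n (fun i => X i ω) (δhat n ω, θhat n ω))
      atTop (id : ℝ → ℝ) (fun _ => μ) (DLE.chiSquared (b - k)) := by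
  obtain ⟨ω₀⟩ : Nonempty Ω := nonempty_of_isProbabilityMeasure μ
  have hcont : ∀ θ ∈ Θ, Continuous (steinFeature (p θ) f) := fun θ hθ =>
    (hstein θ hθ).continuous_steinFeature (hdensity θ hθ)
  have hθs : θs ∈ Θ := hmodel.mem_param
  -- From here on `hmodel.mem_ratio` says that `0` lies in every `Δ n ω`, so the whole slice `δ = 0`
  -- is available.
  obtain rfl : δs = 0 := eq_zero_of_ratio_eq_one hU_open hsmooth (hΘU hθs) hmodel.ratio_eq
    (hunif.integrable 0 ω₀ δs (hmodel.mem_ratio 0 ω₀) θs hθs) hinv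
  have h0 : ∀ n ω, (0 : Vec b) ∈ Δ n ω := hmodel.mem_ratio
  have hQprob : IsProbabilityMeasure Q := (hlaw 0).isProbabilityMeasure_iff.1 inferInstance
  have hsq : ∀ θ ∈ Θ, ∀ i j, Integrable
      (fun x => steinFeature (p θ) f x i * steinFeature (p θ) f x j) Q := fun θ hθ =>
    integrable_mul_steinFeature hU_open hsmooth (hΘU hθ) (fun x => ratio_zero θ)
      (hunif.integrable 0 ω₀ 0 (h0 0 ω₀) θ hθ)
  have hint : ∀ θ ∈ Θ, Integrable (steinFeature (p θ) f) Q := fun θ hθ =>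
    integrable_of_apply fun i => (memLp_apply (hcont θ hθ) (hsq θ hθ) i).integrable (by norm_num)
  have hq : q = p θs := funext fun x => (hmodel.density_eq x).symm
  have hmean : ∫ x, steinFeature (p θs) f x ∂Q = 0 :=
    integral_steinFeature_eq_zero (hstein θs hθs) (hdensity θs hθs) (hq ▸ hQ) (hint θs hθs)
  set T : Vec d → Vec b := steinFeature (p θs) f with hTdef
  have hTm : ∀ j, Measurable fun x => T x j := fun j => by
    have : Continuous fun x => T x j := by
      have := hcont θs hθs
      fun_prop
    exact this.measurable
  have hTL : ∀ j, MemLp (fun x => T x j) 2 Q := memLp_apply (hcont θs hθs) (hsq θs hθs)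
  have hT0 : ∀ j, ∫ x, T x j ∂Q = 0 := fun j => by
    have : ∫ x, T x j ∂Q = (∫ x, T x ∂Q) j :=
      (EuclideanSpace.proj (𝕜 := ℝ) j).integral_comp_comm (hint θs hθs)
    rw [this, hmean]
    rfl
  have hS : (secondMoment T Q).PosDef := by
    refine posDef_secondMoment (hsq θs hθs) ?_
    rwa [meanHessian_toBlocks₁₁ hU_open hsmooth (hΘU hθs) hmodel.ratio_eq, IsUnit.neg_iff] at hinv
  set D := (meanHessian p f Q (0, θs)).toBlocks₁₂ with hDdef
  have hM : meanHessian p f Q (0, θs) = saddleMatrix (secondMoment T Q) D :=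
    meanHessian_eq_saddleMatrix hU_open hsmooth (hΘU hθs)
  rw [min_eq_right hdim.le] at hrank
  obtain ⟨e, he, heo, hpar⟩ := exists_orthonormal_ker hS hrank
  obtain ⟨C, hC, ε₀, hε₀, hpert⟩ := exists_abs_sub_sum_sq_le hS hrank he hpar
  obtain ⟨c, _, _, hc, _, _, hbd⟩ := hbounds
  have hreg : HighProb μ fun n ω => IsRegularMinMax (objective p f n fun i => X i ω) (Δ n ω) Θ c
      (δhat n ω) (θhat n ω) :=
    ((hratio.and hbd).and hestimator).mp fun n ω h =>
      ⟨fun δ hδ θ hθ => contDiffAt_objective hU_open hsmooth (hΘU hθ) (h.1.1 δ hδ θ hθ),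
        fun δ hδ θ hθ => (h.1.2 δ hδ θ hθ).ratio_block, h.2⟩
  have hcons := fun ρ (hρ : 0 < ρ) => highProb_estimator_near hlaw hindep hΘ_compact hΘ_convex
    hΔ_convex hU_open hΘU hsmooth hcont hint h0 hθs hmean hident hunif hc hreg hρ
  have hclt := tendstoInDistribution_chiSquared hlaw hindep
    (g := fun l x => e l ⬝ᵥ (T x).ofLp)
    (fun l => Finset.measurable_fun_sum _ fun j _ => (hTm j).const_mul _)
    (fun l => memLp_finsetSum _ fun j _ => (hTL j).const_mul _)
    (fun l => by
      simp only [dotProduct]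
      rw [integral_finsetSum _ fun j _ => ((hTL j).integrable (by norm_num)).const_mul _]
      simp [integral_const_mul, hT0])
    (fun l l' => by rw [integral_dotProduct_mul_dotProduct (hsq θs hθs), heo])
  -- Slutsky's lemma: it remains to show that the statistic differs from the sum of squares by a
  -- term tending to zero in probability.
  refine tendstoInDistribution_of_tendstoInMeasure_sub _ _ hclt
    (tendstoInMeasure_of_highProb fun η hη => ?_) fun n =>
      (aemeasurable_objective hcont (fun x => (hsmooth x).continuousOn.mono hΘU)
        (fun i => (hlaw i).aemeasurable) (hδhat_meas n) (hθhat_meas n) (hθhat_mem n) n).const_mul _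
  refine (highProb_abs_lt_of_tight
    (V := fun n ω => n * ‖fun j => (n : ℝ)⁻¹ * ∑ i ∈ Finset.range n, T (X i ω) j‖ ^ 2)
    hC hε₀ (fun ε hε hεε₀ => ?_)
    (fun K hK n => measure_lt_mul_norm_sq_sampleMean_le hlaw hindep hTm hTL hT0 hK n) hη)
  refine (highProb_objective_expansion hΘ_convex hΔ_convex hU_open hΘU hsmooth h0 hθs hunif hc
    hreg hcons hε).mp fun n ω ⟨z, hz₁, hz₂⟩ => ?_
  rw [hM] at hz₁ hz₂
  have h := hpert ε hε.le hεε₀ z _ _ hz₁ hz₂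
  -- Scaling by `n` turns the relative error into `C * ε` times the tight sequence `V`, and the
  -- squares into those of the `√n`-normalized sums.
  have h' := mul_le_mul_of_nonneg_left h (Nat.cast_nonneg (α := ℝ) n)
  rw [← abs_of_nonneg (Nat.cast_nonneg (α := ℝ) n), ← abs_mul,
    abs_of_nonneg (Nat.cast_nonneg (α := ℝ) n), mul_sub,
    mul_sum_dotProduct_sampleStein_sq, sampleStein_ofLp] at h'
  simp only [Pi.sub_apply, Pi.zero_apply, sub_zero]
  calc _ = _ := by congr 1; ring
    _ ≤ _ := h'
    _ = _ := by ring
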